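/- Let $f\in C^2(\mathbb R)$, $c\in\mathbb R$, and let $\hat u\in C^2(\mathbb R)$ be the profile of a travelling wave $u(x,t)=\hat u(x-ct)$ of $u_t=u_{xx}+f(u)$ with finite limits $\hat u_\pm=\lim_{\xi\to\pm\infty}\hat u(\xi)$. Put $\phi_\pm(\xi)=f'(\hat u(\xi))-f'(\hat u_\pm)$ and assume that $\phi_-$ is integrable on $(-\infty,0]$ and $\phi_+$ on $[0,\infty)$; let $$\Phi=\int_{-\infty}^0\phi_-(x)\,dx+\int_0^\infty\phi_+(x)\,dx .$$ For $\lambda\in\mathbb C$ let $\kappa_\pm=\sqrt{c^2+4(\lambda-f'(\hat u_\pm))}$, $\mu_\pm^{[1]}=\tfrac12(-c+\kappa_\pm)$ and $\mu_\pm^{[2]}=\tfrac12(-c-\kappa_\pm)$, with principal square roots, and let $\Omega$ be the set of all $\lambda$ such that $\operatorname{Re}\mu_\pm^{[2]}<0<\operatorname{Re}\mu_\pm^{[1]}$ for both signs (for $c\neq0$ this means $\operatorname{Re}\lambda>\max(f'(\hat u_-),f'(\hat u_+))-(\operatorname{Im}\lambda/c)^2$). Then for every $\lambda\in\Omega$ the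 system $$y'=\begin{bmatrix}0&1\\ \lambda-f'(\hat u(\xi))&-c\end{bmatrix}y,\qquad \xi\in\mathbb R,$$ has a unique solution $y_-$ with $e^{-\mu_-^{[1]}\xi}y_-(\xi)\to(1,\mu_-^{[1]})^{\top}$ as $\xi\to-\infty$ and a unique solution $y_+$ with $e^{-\mu_+^{[2]}\xi}y_+(\xi)\to(1,\mu_+^{[2]})^{\top}$ as $\xi\to+\infty$, and the Evans function $D(\lambda)=\det[\,y_-(0)\mid y_+(0)\,]$ satisfies $$D(\lambda)=-2\lambda^{1/2}+\Phi-\tfrac14\lambda^{-1/2}\Big(\Phi^2-2f'(\hat u_-)-2f'(\hat u_+)+c^2\Big)+O(\lambda^{-1})$$ as $|\lambda|\to\infty$ with $\lambda\in\Omega$, where $\lambda^{\pm1/2}$ are principal powers and the constant in $O(\lambda^{-1})$ may depend on $f$, $c$ and $\hat u$. -/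

import Mathlib

open Filter Topology Set MeasureTheory

/-- `u` is the profile of a travelling wave with speed `c`: the function
`(x, t) ↦ u (x - c t)` is a classical solution of `u_t = u_xx + f(u)`. -/
def IsTravellingWave (f : ℝ → ℝ) (c : ℝ) (u : ℝ → ℝ) : Prop :=
  ContDiff ℝ 2 u ∧
    ∀ x t : ℝ,
      deriv (fun s : ℝ => u (x - c * s)) t =
        iteratedDeriv 2 (fun y : ℝ => u (y - c * t)) x + f (u (x - c * t))

/-- The coefficient matrix `A(ξ; z)` of the eigenvalue problem `y' = A y`. -/
noncomputable def evansMatrix (f : ℝ → ℝ) (c : ℝ) (u : ℝ → ℝ) (z : ℂ) (ξ : ℝ) :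
    Matrix (Fin 2) (Fin 2) ℂ :=
  !![0, 1; z - ((deriv f (u ξ) : ℝ) : ℂ), -(c : ℂ)]

/-- `κ = √(c² + 4 (z - f'(q)))` (principal square root), where `q` is a limit state. -/
noncomputable def evansKappa (f : ℝ → ℝ) (c q : ℝ) (z : ℂ) : ℂ :=
  ((c : ℂ) ^ 2 + 4 * (z - ((deriv f q : ℝ) : ℂ))) ^ (1 / 2 : ℂ)

/-- The eigenvalue `μ^{[1]} = (-c + κ) / 2` of the limit matrix at the limit state `q`. -/
noncomputable def evansMu1 (f : ℝ → ℝ) (c q : ℝ) (z : ℂ) : ℂ :=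
  (-(c : ℂ) + evansKappa f c q z) / 2

/-- The eigenvalue `μ^{[2]} = (-c - κ) / 2` of the limit matrix at the limit state `q`. -/
noncomputable def evansMu2 (f : ℝ → ℝ) (c q : ℝ) (z : ℂ) : ℂ :=
  (-(c : ℂ) - evansKappa f c q z) / 2

/-- The set of `z` for which both limit matrices have one eigenvalue with positive and one with
negative real part. For `c ≠ 0` this is
`Re z > max (f'(um)) (f'(up)) - (Im z / c)²`. -/
def evansDomain (f : ℝ → ℝ) (c um up : ℝ) : Set ℂ :=
  {z | 0 < (evansMu1 f c um z).re ∧ (evansMu2 f c um z).re < 0 ∧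
       0 < (evansMu1 f c up z).re ∧ (evansMu2 f c up z).re < 0}

/-- `y` solves `y' = A(ξ; z) y` on the whole real line. -/
def IsEvansSolution (f : ℝ → ℝ) (c : ℝ) (u : ℝ → ℝ) (z : ℂ) (y : ℝ → Fin 2 → ℂ) : Prop :=
  ∀ ξ : ℝ, HasDerivAt y ((evansMatrix f c u z ξ).mulVec (y ξ)) ξ

/-- `y` is the solution with `y(ξ) ∼ exp(μ₋^{[1]} ξ) (1, μ₋^{[1]})ᵀ` as `ξ → -∞`. -/
def IsLeftSolution (f : ℝ → ℝ) (c : ℝ) (u : ℝ → ℝ) (um : ℝ) (z : ℂ)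
    (y : ℝ → Fin 2 → ℂ) : Prop :=
  IsEvansSolution f c u z y ∧
    Tendsto (fun ξ : ℝ => Complex.exp (-(evansMu1 f c um z * (ξ : ℂ))) • y ξ) atBot
      (𝓝 ![1, evansMu1 f c um z])

/-- `y` is the solution with `y(ξ) ∼ exp(μ₊^{[2]} ξ) (1, μ₊^{[2]})ᵀ` as `ξ → +∞`. -/
def IsRightSolution (f : ℝ → ℝ) (c : ℝ) (u : ℝ → ℝ) (up : ℝ) (z : ℂ)
    (y : ℝ → Fin 2 → ℂ) : Prop :=
  IsEvansSolution f c u z y ∧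
    Tendsto (fun ξ : ℝ => Complex.exp (-(evansMu2 f c up z * (ξ : ℂ))) • y ξ) atTop
      (𝓝 ![1, evansMu2 f c up z])

/-- The solution `y₋` (an arbitrary function if there is none). -/
noncomputable def evansLeft (f : ℝ → ℝ) (c : ℝ) (u : ℝ → ℝ) (um : ℝ) (z : ℂ) :
    ℝ → Fin 2 → ℂ :=
  Classical.epsilon (IsLeftSolution f c u um z)

/-- The solution `y₊` (an arbitrary function if there is none). -/
noncomputable def evansRight (f : ℝ → ℝ) (c : ℝ) (u : ℝ → ℝ) (up : ℝ) (z : ℂ) :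
    ℝ → Fin 2 → ℂ :=
  Classical.epsilon (IsRightSolution f c u up z)

/-- The Evans function `D(z) = det [y₋(0) | y₊(0)]`. -/
noncomputable def evansFunction (f : ℝ → ℝ) (c : ℝ) (u : ℝ → ℝ) (um up : ℝ) (z : ℂ) : ℂ :=
  Matrix.det !![evansLeft f c u um z 0 0, evansRight f c u up z 0 0;
                evansLeft f c u um z 0 1, evansRight f c u up z 0 1]

/-- `φ(ξ) = f'(u(ξ)) - f'(q)`, where `q` is a limit state. -/
noncomputable def evansPhi (f u : ℝ → ℝ) (q ξ : ℝ) : ℝ :=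
  deriv f (u ξ) - deriv f q

/-- `Φ = ∫_{-∞}^0 φ₋ + ∫_0^∞ φ₊`. -/
noncomputable def evansPhiTotal (f u : ℝ → ℝ) (um up : ℝ) : ℝ :=
  (∫ x in Iic (0 : ℝ), evansPhi f u um x) + ∫ x in Ioi (0 : ℝ), evansPhi f u up x

/-! Factoring out the exponential, `y = e^{μξ} (w, μ w + w')`, turns the system into `w'' = -κ w' -
φ w` with `w → 1`, `w' → 0` at `-∞`. The right-hand solution is the same object for the reflected
profile `u(-x)`, which travels with speed `-c`, so only `-∞` is analysed. Existence comes from the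
Volterra equation with kernel `κ⁻¹ (1 - e^{-κ(x-t)})` (`exists_isJost`). Uniqueness holds because
`e^{cξ}` times the Wronskian is constant, while the common normalisation forces it to vanish
(`IsEvansSolution.eq_of_tendsto`).

For the asymptotics, `κ w + w' = κ - ∫ φ w` (`IsJost.mul_add_eq`) reduces `w(0)` to `w'(0)` and `P =
∫ φ w`. Iteration gives `P = I - I²/(2κ) + O(κ⁻²)` with `I = ∫ φ`. In the determinant the leading
contributions of both `w'(0)` cancel, so `w'(0) = O(κ⁻¹)` suffices and no expansion of it is needed
(`exists_det_expansion`).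

The delicate point is that this bound must be uniform on `Ω`, where `Re κ` can stay bounded as `|κ|
→ ∞`. One integration by parts gains the factor `κ⁻¹` but leaves a damped integral of `φ'` to
control. For `c ≠ 0` the damping rate exceeds `|c|` and boundedness of `φ'` is enough. For `c = 0`
the rate may tend to `0` and `φ'` must be integrable: by reversibility `u'` has at most one zero
unless `u` is constant, so `u` has finite total variation (`IsFrontProfile.exists_comparison`). -/

/-! ### Calculus of integrals over `(-∞, x]`. -/

section HalfLineIntegrals

variable {E : Type*} [NormedAddCommGroup E] {g : ℝ → E}

theorem integrableOn_Iic_of_continuous (hg : Continuous g) (hi : IntegrableOn g (Iic 0)) (x : ℝ) :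
    IntegrableOn g (Iic x) := by
  have h : IntegrableOn g (Icc 0 x) := hg.continuousOn.integrableOn_compact isCompact_Icc
  refine (hi.union h).mono_set fun t ht => ?_
  rcases le_total t 0 with h0 | h0
  · exact Or.inl h0
  · exact Or.inr ⟨h0, ht⟩

variable [NormedSpace ℝ E]

theorem integral_Iic_eq_add (hg : Continuous g) (hi : IntegrableOn g (Iic 0)) (x : ℝ) :
    ∫ t in Iic x, g t = (∫ t in Iic 0, g t) + ∫ t in (0 : ℝ)..x, g t := by
  rw [← intervalIntegral.integral_Iic_sub_Iic hi (integrableOn_Iic_of_continuous hg hi x)]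
  abel

theorem hasDerivAt_integral_Iic [CompleteSpace E] (hg : Continuous g)
    (hi : IntegrableOn g (Iic 0)) (x : ℝ) :
    HasDerivAt (fun y => ∫ t in Iic y, g t) (g x) x := by
  have h := (hg.integral_hasStrictDerivAt 0 x).hasDerivAt.const_add (∫ t in Iic 0, g t)
  exact h.congr_of_eventuallyEq (Eventually.of_forall fun y => integral_Iic_eq_add hg hi y)

theorem tendsto_integral_Iic_atBot (hg : Continuous g) (hi : IntegrableOn g (Iic 0)) :
    Tendsto (fun y => ∫ t in Iic y, g t) atBot (𝓝 0) := by
  have h := (intervalIntegral_tendsto_integral_Iic 0 hi tendsto_id).const_sub (∫ t in Iic 0, g t)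
  rw [sub_self] at h
  refine h.congr fun y => ?_
  rw [integral_Iic_eq_add hg hi y, intervalIntegral.integral_symm, id, sub_neg_eq_add]

end HalfLineIntegrals

/-! ### The damped integral and the Volterra operator. -/

section Damped

/-- The solution `∫_{-∞}^x e^{-κ (x - t)} ψ(t) dt` of `V' = -κ V + ψ`. -/
noncomputable def dampedIntegral (κ : ℂ) (ψ : ℝ → ℂ) (x : ℝ) : ℂ :=
  Complex.exp (-(κ * x)) * ∫ t in Iic x, Complex.exp (κ * t) * ψ t

variable {κ : ℂ} {ψ : ℝ → ℂ}

theorem norm_exp_mul_ofReal (κ : ℂ) (t : ℝ) : ‖Complex.exp (κ * t)‖ = Real.exp (κ.re * t) := by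
  rw [Complex.norm_exp]; simp

theorem integrableOn_exp_mul (hκ : 0 < κ.re) (hi : IntegrableOn ψ (Iic 0)) :
    IntegrableOn (fun t : ℝ => Complex.exp (κ * t) * ψ t) (Iic 0) := by
  refine Integrable.bdd_mul (c := 1) hi (by fun_prop) ?_
  filter_upwards [ae_restrict_mem measurableSet_Iic] with t ht
  rw [norm_exp_mul_ofReal]
  exact Real.exp_le_one_iff.2 (mul_nonpos_of_nonneg_of_nonpos hκ.le ht)

theorem hasDerivAt_dampedIntegral (hκ : 0 < κ.re) (hψ : Continuous ψ)
    (hi : IntegrableOn ψ (Iic 0)) (x : ℝ) :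
    HasDerivAt (dampedIntegral κ ψ) (-κ * dampedIntegral κ ψ x + ψ x) x := by
  have h1 : HasDerivAt (fun y : ℝ => Complex.exp (-(κ * y))) (Complex.exp (-(κ * x)) * -κ) x := by
    have : HasDerivAt (fun y : ℝ => -(κ * (y : ℂ))) (-κ) x := by
      simpa using ((Complex.ofRealCLM.hasDerivAt (x := x)).const_mul κ).fun_neg
    exact this.cexp
  have h2 := hasDerivAt_integral_Iic (g := fun t : ℝ => Complex.exp (κ * t) * ψ t) (by fun_prop)
    (integrableOn_exp_mul hκ hi) x
  refine (h1.mul h2).congr_deriv ?_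
  rw [dampedIntegral, ← mul_assoc (Complex.exp _) (Complex.exp _), ← Complex.exp_add]
  simp only [neg_add_cancel, Complex.exp_zero]
  ring

theorem norm_dampedIntegral_le (hκ : 0 < κ.re) (hψ : Continuous ψ)
    (hi : IntegrableOn ψ (Iic 0)) (x : ℝ) :
    ‖dampedIntegral κ ψ x‖ ≤ ∫ t in Iic x, ‖ψ t‖ := by
  rw [dampedIntegral, ← integral_const_mul]
  refine norm_integral_le_of_norm_le (integrableOn_Iic_of_continuous hψ hi x).norm ?_
  filter_upwards [ae_restrict_mem measurableSet_Iic] with t ht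
  rw [← mul_assoc, ← Complex.exp_add, norm_mul]
  refine mul_le_of_le_one_left (norm_nonneg _) ?_
  rw [show -(κ * x) + κ * t = κ * ((t - x : ℝ) : ℂ) by push_cast; ring, norm_exp_mul_ofReal]
  exact Real.exp_le_one_iff.2 (mul_nonpos_of_nonneg_of_nonpos hκ.le (sub_nonpos.2 ht))

theorem dampedIntegral_sub (hκ : 0 < κ.re) {ψ' : ℝ → ℂ} (hψ : Continuous ψ)
    (hi : IntegrableOn ψ (Iic 0)) (hψ' : Continuous ψ') (hi' : IntegrableOn ψ' (Iic 0)) (x : ℝ) :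
    dampedIntegral κ (fun t => ψ t - ψ' t) x
      = dampedIntegral κ ψ x - dampedIntegral κ ψ' x := by
  simp only [dampedIntegral, mul_sub]
  rw [integral_sub, mul_sub]
  · exact integrableOn_Iic_of_continuous (by fun_prop) (integrableOn_exp_mul hκ hi) x
  · exact integrableOn_Iic_of_continuous (by fun_prop) (integrableOn_exp_mul hκ hi') x

/-- The operator `ψ ↦ ∫_{-∞}^x κ⁻¹ (1 - e^{-κ (x - t)}) ψ(t) dt`. -/
noncomputable def volterra (κ : ℂ) (ψ : ℝ → ℂ) (x : ℝ) : ℂ :=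
  ((∫ t in Iic x, ψ t) - dampedIntegral κ ψ x) / κ

theorem hasDerivAt_volterra (hκ : 0 < κ.re) (hψ : Continuous ψ)
    (hi : IntegrableOn ψ (Iic 0)) (x : ℝ) :
    HasDerivAt (volterra κ ψ) (dampedIntegral κ ψ x) x := by
  have h := ((hasDerivAt_integral_Iic hψ hi x).sub (hasDerivAt_dampedIntegral hκ hψ hi x)).div_const κ
  refine h.congr_deriv ?_
  have : κ ≠ 0 := by rintro rfl; simp at hκ
  field_simp
  ring

theorem norm_volterra_le (hκ : 0 < κ.re) (hψ : Continuous ψ)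
    (hi : IntegrableOn ψ (Iic 0)) (x : ℝ) :
    ‖volterra κ ψ x‖ ≤ 2 / ‖κ‖ * ∫ t in Iic x, ‖ψ t‖ := by
  rw [volterra, norm_div, div_mul_eq_mul_div]
  gcongr
  calc _ ≤ ‖∫ t in Iic x, ψ t‖ + ‖dampedIntegral κ ψ x‖ := norm_sub_le _ _
    _ ≤ (∫ t in Iic x, ‖ψ t‖) + ∫ t in Iic x, ‖ψ t‖ :=
      add_le_add (norm_integral_le_integral_norm _) (norm_dampedIntegral_le hκ hψ hi x)
    _ = _ := by ring

theorem volterra_sub (hκ : 0 < κ.re) {ψ' : ℝ → ℂ} (hψ : Continuous ψ)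
    (hi : IntegrableOn ψ (Iic 0)) (hψ' : Continuous ψ') (hi' : IntegrableOn ψ' (Iic 0)) (x : ℝ) :
    volterra κ (fun t => ψ t - ψ' t) x = volterra κ ψ x - volterra κ ψ' x := by
  simp only [volterra]
  rw [dampedIntegral_sub hκ hψ hi hψ' hi', integral_sub
    (integrableOn_Iic_of_continuous hψ hi x) (integrableOn_Iic_of_continuous hψ' hi' x)]
  ring

end Damped

/-- `w` is the normalised solution at `-∞` of `w'' = -κ w' - φ w`, with derivative `w'`. -/
structure IsJost (φ : ℝ → ℝ) (κ : ℂ) (w w' : ℝ → ℂ) : Prop where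
  hasDerivAt : ∀ x, HasDerivAt w (w' x) x
  hasDerivAt' : ∀ x, HasDerivAt w' (-κ * w' x - φ x * w x) x
  tendsto : Tendsto w atBot (𝓝 1)
  tendsto' : Tendsto w' atBot (𝓝 0)

/-! ### Existence of the normalised solution at `-∞`. -/

section Existence

variable {φ : ℝ → ℝ} {κ : ℂ}

theorem integral_Iic_abs_mono (hφ : Continuous φ) (hi : IntegrableOn φ (Iic 0)) :
    Monotone fun x => ∫ t in Iic x, |φ t| :=
  monotone_of_hasDerivAt_nonneg (hasDerivAt_integral_Iic hφ.abs hi.abs) fun _ => abs_nonneg _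

/-- With `h(x) = ∫_{-∞}^x |φ|`, the integrand is the derivative of `e^{M h} / M`, and `h → 0` at
`-∞`. This makes `e^{M h}` the right weight for the contraction below. -/
theorem integral_Iic_abs_mul_exp (hφ : Continuous φ) (hi : IntegrableOn φ (Iic 0)) {M : ℝ}
    (hM : 0 < M) (x : ℝ) :
    IntegrableOn (fun t => |φ t| * Real.exp (M * ∫ s in Iic t, |φ s|)) (Iic x) ∧
    ∫ t in Iic x, |φ t| * Real.exp (M * ∫ s in Iic t, |φ s|)
      = (Real.exp (M * ∫ s in Iic x, |φ s|) - 1) / M := by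
  have hd := hasDerivAt_integral_Iic hφ.abs hi.abs
  have hc : Continuous fun t => ∫ s in Iic t, |φ s| :=
    continuous_iff_continuousAt.2 fun t => (hd t).continuousAt
  have hd' : ∀ t, HasDerivAt (fun t => Real.exp (M * ∫ s in Iic t, |φ s|) / M)
      (|φ t| * Real.exp (M * ∫ s in Iic t, |φ s|)) t := fun t => by
    refine (((hd t).const_mul M).exp.div_const M).congr_deriv ?_
    field_simp
  have hint : IntegrableOn (fun t => |φ t| * Real.exp (M * ∫ s in Iic t, |φ s|)) (Iic x) := by
    refine Integrable.mul_bdd (c := Real.exp (M * ∫ s in Iic x, |φ s|))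
      (integrableOn_Iic_of_continuous hφ.abs hi.abs x)
      (Real.continuous_exp.comp (hc.const_mul M)).aestronglyMeasurable ?_
    filter_upwards [ae_restrict_mem measurableSet_Iic] with t ht
    rw [Real.norm_eq_abs, Real.abs_exp]
    have := integral_Iic_abs_mono hφ hi ht
    gcongr
  refine ⟨hint, ?_⟩
  have hl : Tendsto (fun t => Real.exp (M * ∫ s in Iic t, |φ s|) / M) atBot (𝓝 (1 / M)) := by
    have := (((tendsto_integral_Iic_atBot hφ.abs hi.abs).const_mul M).rexp).div_const M
    simpa using this
  rw [integral_Iic_of_hasDerivAt_of_tendsto (hd' x).continuousAt.continuousWithinAt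
    (fun t _ => hd' t) hint hl]
  ring

/-- Banach's fixed point theorem for `w = 1 - volterra κ (φ w)`, in the unknown `v = w / e^{M h}`.
The weight makes the map a contraction for every `κ` with positive real part, with no smallness of
`φ`. -/
theorem exists_isJost (hφ : Continuous φ) (hi : IntegrableOn φ (Iic 0)) (hκ : 0 < κ.re) :
    ∃ w w', IsJost φ κ w w' := by
  have hκ0 : 0 < ‖κ‖ := norm_pos_iff.2 (by rintro rfl; simp at hκ)
  set h : ℝ → ℝ := fun x => ∫ s in Iic x, |φ s| with hh
  -- The Volterra kernel is bounded by `2 / ‖κ‖` and integrating the weight gains `1 / M`, so this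
  -- `M` gives contraction constant `1/2`.
  set M : ℝ := 4 / ‖κ‖ with hMdef
  have hM : 0 < M := by positivity
  have hhd := hasDerivAt_integral_Iic hφ.abs hi.abs
  have hhc : Continuous h := continuous_iff_continuousAt.2 fun t => (hhd t).continuousAt
  set e : ℝ → ℝ := fun x => Real.exp (M * h x) with he
  have hec : Continuous e := by fun_prop
  have hepos : ∀ x, 0 < e x := fun x => Real.exp_pos _
  let ψ : (BoundedContinuousFunction ℝ ℂ) → ℝ → ℂ := fun v t => ((φ t * e t : ℝ) : ℂ) * v t
  have hψc : ∀ v, Continuous (ψ v) := fun v => by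
    have := v.continuous
    exact (Complex.continuous_ofReal.comp (hφ.mul hec)).mul this
  have hψn : ∀ v t, ‖ψ v t‖ ≤ |φ t| * e t * ‖v‖ := fun v t => by
    simp only [ψ, norm_mul, Complex.norm_real, Real.norm_eq_abs, abs_of_pos (hepos t)]
    have := v.norm_coe_le_norm t
    have := (hepos t).le
    gcongr
  have hψi : ∀ v, IntegrableOn (ψ v) (Iic 0) := fun v => by
    refine Integrable.mono' ((integral_Iic_abs_mul_exp hφ hi hM 0).1.mul_const ‖v‖)
      (hψc v).aestronglyMeasurable (Eventually.of_forall fun t => hψn v t)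
  have hvol : ∀ v x, ‖volterra κ (ψ v) x‖ ≤ (e x - 1) / 2 * ‖v‖ := fun v x => by
    refine (norm_volterra_le hκ (hψc v) (hψi v) x).trans ?_
    have h1 : ∫ t in Iic x, ‖ψ v t‖ ≤ (e x - 1) / M * ‖v‖ := by
      rw [he, ← (integral_Iic_abs_mul_exp hφ hi hM x).2, ← integral_mul_const]
      refine integral_mono (integrableOn_Iic_of_continuous (hψc v) (hψi v) x).norm
        ((integral_Iic_abs_mul_exp hφ hi hM x).1.mul_const ‖v‖) (fun t => hψn v t)
    calc _ ≤ 2 / ‖κ‖ * ((e x - 1) / M * ‖v‖) := by gcongr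
      _ = _ := by rw [hMdef]; field_simp; ring
  have hvc : ∀ v, Continuous (volterra κ (ψ v)) := fun v =>
    continuous_iff_continuousAt.2 fun t => (hasDerivAt_volterra hκ (hψc v) (hψi v) t).continuousAt
  have he1 : ∀ x, 1 ≤ e x := fun x =>
    Real.one_le_exp (mul_nonneg hM.le (integral_nonneg fun t => abs_nonneg _))
  let T : BoundedContinuousFunction ℝ ℂ → BoundedContinuousFunction ℝ ℂ := fun v =>
    BoundedContinuousFunction.ofNormedAddCommGroup
      (fun x => ((e x : ℝ) : ℂ)⁻¹ * (1 - volterra κ (ψ v) x))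
      (by
        have := hvc v
        refine Continuous.mul (Continuous.inv₀ (by fun_prop) fun x => ?_) (by fun_prop)
        exact_mod_cast (hepos x).ne')
      (1 + ‖v‖) (fun x => by
        rw [norm_mul, norm_inv, Complex.norm_real, Real.norm_eq_abs, abs_of_pos (hepos x),
          inv_mul_le_iff₀ (hepos x)]
        have h1 := hvol v x
        have h2 := norm_sub_le (1 : ℂ) (volterra κ (ψ v) x)
        rw [norm_one] at h2
        nlinarith [he1 x, norm_nonneg v])
  have hT : ∀ v x, T v x = ((e x : ℝ) : ℂ)⁻¹ * (1 - volterra κ (ψ v) x) := fun _ _ => rfl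
  have hcontr : ContractingWith (1 / 2) T := by
    refine ⟨by norm_num, LipschitzWith.of_dist_le_mul fun v₁ v₂ => ?_⟩
    rw [BoundedContinuousFunction.dist_le (by positivity)]
    intro x
    have hsub : volterra κ (ψ v₁) x - volterra κ (ψ v₂) x = volterra κ (ψ (v₁ - v₂)) x := by
      rw [← volterra_sub hκ (hψc _) (hψi _) (hψc _) (hψi _)]
      congr 1
      ext t
      simp [ψ, mul_sub]
    rw [dist_eq_norm, hT, hT, ← mul_sub, sub_sub_sub_cancel_left, norm_mul, norm_inv,
      Complex.norm_real, Real.norm_eq_abs, abs_of_pos (hepos x), inv_mul_le_iff₀ (hepos x),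
      norm_sub_rev, hsub, dist_eq_norm]
    refine (hvol _ x).trans ?_
    have : ((1 / 2 : NNReal) : ℝ) = 1 / 2 := by norm_num
    rw [this]
    nlinarith [he1 x, norm_nonneg (v₁ - v₂)]
  obtain ⟨v, hv⟩ : ∃ v, T v = v := ⟨_, hcontr.fixedPoint_isFixedPt⟩
  have hw : ∀ x, 1 - volterra κ (ψ v) x = e x * v x := fun x => by
    have h1 := hT v x
    rw [hv] at h1
    rw [h1, mul_inv_cancel_left₀]
    exact_mod_cast (hepos x).ne'
  have h0 : Tendsto (fun x => ∫ t in Iic x, ‖ψ v t‖) atBot (𝓝 0) :=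
    tendsto_integral_Iic_atBot (hψc v).norm (hψi v).norm
  refine ⟨fun x => 1 - volterra κ (ψ v) x, fun x => -dampedIntegral κ (ψ v) x, ?_, ?_, ?_, ?_⟩
  · intro x
    exact (hasDerivAt_volterra hκ (hψc v) (hψi v) x).const_sub 1
  · intro x
    refine (hasDerivAt_dampedIntegral hκ (hψc v) (hψi v) x).neg.congr_deriv ?_
    rw [hw]
    simp only [ψ]
    push_cast
    ring
  · have h1 : Tendsto (volterra κ (ψ v)) atBot (𝓝 0) := by
      refine squeeze_zero_norm (norm_volterra_le hκ (hψc v) (hψi v)) ?_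
      simpa using h0.const_mul (2 / ‖κ‖)
    simpa using h1.const_sub 1
  · have h1 : Tendsto (dampedIntegral κ (ψ v)) atBot (𝓝 0) :=
      squeeze_zero_norm (norm_dampedIntegral_le hκ (hψc v) (hψi v)) h0
    simpa using h1.neg

end Existence

/-- A comparison principle for `V' = -κ V + r` on `(-∞, 0]`. -/
theorem norm_le_of_damped_comparison {κ : ℂ} (hκ : 0 < κ.re) {V r : ℝ → ℂ} {ρ ρ' : ℝ → ℝ}
    (hV : ∀ x ≤ 0, HasDerivAt V (-κ * V x + r x) x) (hV0 : Tendsto V atBot (𝓝 0))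
    (hρ : ∀ x ≤ 0, HasDerivAt ρ (ρ' x) x) (hρ0 : ∀ x ≤ 0, 0 ≤ ρ x)
    (hr : ∀ x ≤ 0, ‖r x‖ ≤ ρ' x + κ.re * ρ x) {x : ℝ} (hx : x ≤ 0) : ‖V x‖ ≤ ρ x := by
  -- Comparison on `[a, x]` after removing the damping by the factor `e^{κ(t-a)}`. The price `‖V a‖`
  -- vanishes as `a → -∞`.
  have key : ∀ a ≤ x, ‖V x‖ ≤ ρ x + ‖V a‖ := by
    intro a ha
    have hf : ∀ t ≤ 0, HasDerivAt (fun t : ℝ => Complex.exp (κ * ((t - a : ℝ) : ℂ)) * V t)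
        (Complex.exp (κ * ((t - a : ℝ) : ℂ)) * r t) t := fun t ht => by
      have h1 : HasDerivAt (fun t : ℝ => κ * ((t - a : ℝ) : ℂ)) κ t := by
        simpa using (((hasDerivAt_id t).sub_const a).ofReal_comp).const_mul κ
      refine (h1.cexp.mul (hV t ht)).congr_deriv ?_
      ring
    have hB : ∀ t ≤ 0, HasDerivAt (fun t : ℝ => Real.exp (κ.re * (t - a)) * ρ t + ‖V a‖)
        (Real.exp (κ.re * (t - a)) * (ρ' t + κ.re * ρ t)) t := fun t ht => by
      have h1 : HasDerivAt (fun t : ℝ => κ.re * (t - a)) κ.re t := by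
        simpa using ((hasDerivAt_id t).sub_const a).const_mul κ.re
      refine ((h1.exp.mul (hρ t ht)).add_const ‖V a‖).congr_deriv ?_
      ring
    have hmain := image_norm_le_of_norm_deriv_right_le_deriv_boundary' (a := a) (b := x)
      (fun t ht => (hf t (ht.2.trans hx)).continuousAt.continuousWithinAt)
      (fun t ht => (hf t (ht.2.le.trans hx)).hasDerivWithinAt)
      (B := fun t : ℝ => Real.exp (κ.re * (t - a)) * ρ t + ‖V a‖)
      (by simpa using hρ0 a (ha.trans hx))
      (fun t ht => (hB t (ht.2.trans hx)).continuousAt.continuousWithinAt)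
      (fun t ht => (hB t (ht.2.le.trans hx)).hasDerivWithinAt)
      (fun t ht => by
        rw [norm_mul, norm_exp_mul_ofReal]
        exact mul_le_mul_of_nonneg_left (hr t (ht.2.le.trans hx)) (Real.exp_pos _).le)
      (right_mem_Icc.2 ha)
    rw [norm_mul, norm_exp_mul_ofReal] at hmain
    have h1 : 1 ≤ Real.exp (κ.re * (x - a)) :=
      Real.one_le_exp (mul_nonneg hκ.le (sub_nonneg.2 ha))
    refine le_of_mul_le_mul_left ?_ (Real.exp_pos (κ.re * (x - a)))
    rw [mul_add]
    exact hmain.trans (add_le_add_right (le_mul_of_one_le_left (norm_nonneg _) h1) _)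
  refine ge_of_tendsto (x := atBot) (f := fun a => ρ x + ‖V a‖) ?_
    ((eventually_le_atBot x).mono key)
  simpa using hV0.norm.const_add (ρ x)

theorem exists_norm_le_Iic_of_tendsto {E : Type*} [NormedAddCommGroup E] {w : ℝ → E} {l : E}
    (hw : Continuous w) (hl : Tendsto w atBot (𝓝 l)) (b : ℝ) : ∃ C, ∀ x ≤ b, ‖w x‖ ≤ C := by
  obtain ⟨a, ha⟩ := eventually_atBot.1 (hl.norm.eventually (eventually_le_nhds (lt_add_one ‖l‖)))
  obtain ⟨C, hC⟩ := (isCompact_Icc (a := a) (b := b)).exists_bound_of_continuousOn hw.continuousOn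
  refine ⟨max C (‖l‖ + 1), fun x hx => ?_⟩
  rcases le_total x a with h | h
  · exact (ha x h).trans (le_max_right _ _)
  · exact (hC x ⟨h, hx⟩).trans (le_max_left _ _)

/-! ### Bounds on the normalised solution for large `|κ|`. -/

namespace IsJost

variable {φ : ℝ → ℝ} {κ : ℂ} {w w' : ℝ → ℂ}

theorem continuous (h : IsJost φ κ w w') : Continuous w :=
  continuous_iff_continuousAt.2 fun x => (h.hasDerivAt x).continuousAt

theorem integrableOn (h : IsJost φ κ w w') (hi : IntegrableOn φ (Iic 0)) :
    IntegrableOn (fun t => φ t * w t) (Iic 0) := by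
  obtain ⟨C, hC⟩ := exists_norm_le_Iic_of_tendsto h.continuous h.tendsto 0
  refine Integrable.mul_bdd (c := C) hi.ofReal h.continuous.aestronglyMeasurable ?_
  filter_upwards [ae_restrict_mem measurableSet_Iic] with t ht using hC t ht

/-- The equation says `(κ w + w')' = -φ w`; integrate from `-∞`, where `κ w + w' → κ`. -/
theorem mul_add_eq (h : IsJost φ κ w w') (hφ : Continuous φ) (hi : IntegrableOn φ (Iic 0))
    (x : ℝ) : κ * w x + w' x = κ - ∫ t in Iic x, φ t * w t := by
  have hw := h.continuous
  have hd : ∀ t, HasDerivAt (fun t => -(κ * w t + w' t)) (φ t * w t) t := fun t => by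
    refine (((h.hasDerivAt t).const_mul κ).add (h.hasDerivAt' t)).neg.congr_deriv ?_
    ring
  have hl : Tendsto (fun t => -(κ * w t + w' t)) atBot (𝓝 (-κ)) := by
    simpa using ((h.tendsto.const_mul κ).add h.tendsto').neg
  rw [integral_Iic_of_hasDerivAt_of_tendsto (hd x).continuousAt.continuousWithinAt
    (fun t _ => hd t) (integrableOn_Iic_of_continuous (by fun_prop) (h.integrableOn hi) x) hl]
  ring

theorem norm_deriv_le (h : IsJost φ κ w w') (hφ : Continuous φ) (hi : IntegrableOn φ (Iic 0))
    (hκ : 0 < κ.re) {x : ℝ} (hx : x ≤ 0) : ‖w' x‖ ≤ ∫ t in Iic x, ‖φ t * w t‖ := by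
  have hw := h.continuous
  have hc : Continuous fun t => φ t * w t := by fun_prop
  have h0 : ∀ t : ℝ, 0 ≤ ∫ s in Iic t, ‖φ s * w s‖ := fun t =>
    integral_nonneg fun s => norm_nonneg _
  refine norm_le_of_damped_comparison hκ (r := fun t => -(φ t * w t))
    (fun t _ => (h.hasDerivAt' t).congr_deriv (by ring)) h.tendsto'
    (fun t _ => hasDerivAt_integral_Iic hc.norm (h.integrableOn hi).norm t) (fun t _ => h0 t)
    (fun t _ => ?_) hx
  rw [norm_neg]
  exact le_add_of_nonneg_right (mul_nonneg hκ.le (h0 t))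

theorem integral_norm_mul_le {g : ℝ → ℂ} (hφ : Continuous φ) (hi : IntegrableOn φ (Iic 0))
    {S : ℝ} (hS : ∀ t ≤ 0, ‖g t‖ ≤ S) {x : ℝ} (hx : x ≤ 0) :
    ∫ t in Iic x, ‖φ t * g t‖ ≤ S * ∫ t in Iic 0, |φ t| := by
  have hS0 : 0 ≤ S := (norm_nonneg _).trans (hS 0 le_rfl)
  calc ∫ t in Iic x, ‖φ t * g t‖ ≤ ∫ t in Iic x, S * |φ t| := by
        refine integral_mono_of_nonneg (Eventually.of_forall fun t => norm_nonneg _)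
          ((integrableOn_Iic_of_continuous hφ.abs hi.abs x).const_mul S) ?_
        filter_upwards [ae_restrict_mem measurableSet_Iic] with t ht
        rw [norm_mul, Complex.norm_real, Real.norm_eq_abs, mul_comm]
        exact mul_le_mul_of_nonneg_right (hS t (le_trans ht hx)) (abs_nonneg _)
    _ = S * ∫ t in Iic x, |φ t| := integral_const_mul _ _
    _ ≤ _ := mul_le_mul_of_nonneg_left (integral_Iic_abs_mono hφ hi hx) hS0

/-- The supremum `S` of `‖w‖` on `(-∞, 0]` is finite because `w` converges at `-∞`. Inserting it
into `mul_add_eq` and `norm_deriv_le` gives `S ≤ 1 + S/2`. -/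
theorem norm_le_two (h : IsJost φ κ w w') (hφ : Continuous φ) (hi : IntegrableOn φ (Iic 0))
    (hκ : 0 < κ.re) (hκ4 : 4 * ∫ t in Iic 0, |φ t| ≤ ‖κ‖) {x : ℝ} (hx : x ≤ 0) : ‖w x‖ ≤ 2 := by
  have hκ0 : 0 < ‖κ‖ := norm_pos_iff.2 (by rintro rfl; simp at hκ)
  obtain ⟨C, hC⟩ := exists_norm_le_Iic_of_tendsto h.continuous h.tendsto 0
  set S := sSup ((fun t => ‖w t‖) '' Iic 0) with hSdef
  have hS : ∀ t ≤ 0, ‖w t‖ ≤ S := fun t ht =>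
    le_csSup ⟨C, by rintro _ ⟨s, hs, rfl⟩; exact hC s hs⟩ ⟨t, ht, rfl⟩
  have hS0 : 0 ≤ S := (norm_nonneg _).trans (hS 0 le_rfl)
  have hS1 : S ≤ 1 + S / 2 := by
    refine csSup_le (nonempty_Iic.image _) ?_
    rintro _ ⟨t, ht, rfl⟩
    have h1 : κ * w t = κ - ((∫ s in Iic t, φ s * w s) + w' t) := by
      rw [← sub_sub, ← h.mul_add_eq hφ hi]; ring
    have h2 : ‖κ‖ * ‖w t‖ ≤ ‖κ‖ + 2 * (S * ∫ t in Iic 0, |φ t|) := by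
      rw [← norm_mul, h1]
      have h3 := norm_sub_le κ ((∫ s in Iic t, φ s * w s) + w' t)
      have h4 := norm_add_le (∫ s in Iic t, φ s * w s) (w' t)
      have h5 := norm_integral_le_integral_norm (μ := volume.restrict (Iic t))
        (fun s => φ s * w s)
      have h6 := h.norm_deriv_le hφ hi hκ ht
      have h7 := integral_norm_mul_le hφ hi hS ht
      linarith
    refine le_of_mul_le_mul_left (h2.trans ?_) hκ0
    nlinarith
  exact (hS x hx).trans (by linarith)

/-- Bounds for the solution as `|κ| → ∞`, uniform over those `κ` for which the derivative of `φ`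
is dominated by a bounded comparison function. -/
theorem exists_bounds {φ' : ℝ → ℝ} (hφ' : ∀ x, HasDerivAt φ (φ' x) x)
    (hi : IntegrableOn φ (Iic 0)) (hφ0 : Tendsto φ atBot (𝓝 0)) (B : ℝ) :
    ∃ C, ∀ (κ : ℂ) (w w' : ℝ → ℂ), 0 < κ.re → 4 * ∫ t in Iic 0, |φ t| ≤ ‖κ‖ →
      (∃ ρ ρ' : ℝ → ℝ, ∀ x ≤ 0, HasDerivAt ρ (ρ' x) x ∧ 0 ≤ ρ x ∧ ρ x ≤ B ∧
        |φ' x| ≤ ρ' x + κ.re * ρ x) →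
      IsJost φ κ w w' →
      ‖w' 0‖ ≤ C / ‖κ‖ ∧
      ‖(∫ t in Iic 0, φ t * w t) -
        (((∫ t in Iic 0, φ t : ℝ) : ℂ) - ((∫ t in Iic 0, φ t : ℝ) : ℂ) ^ 2 / (2 * κ))‖
          ≤ C / ‖κ‖ ^ 2 := by
  have hφ : Continuous φ := continuous_iff_continuousAt.2 fun x => (hφ' x).continuousAt
  obtain ⟨A, hA⟩ := exists_norm_le_Iic_of_tendsto hφ hφ0 0
  set N := ∫ t in Iic 0, |φ t| with hN
  have hN0 : 0 ≤ N := integral_nonneg fun t => abs_nonneg _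
  -- The first two terms bound `κ (w' + φ w / κ)` through the comparison function; the last bounds
  -- `φ w`.
  set C₁ := 2 * B + 2 * N * N + 2 * A with hC₁
  refine ⟨max C₁ (N * (C₁ + 4 * N * N)), fun κ w w' hκ hκ4 hρ h => ?_⟩
  obtain ⟨ρ, ρ', hρ⟩ := hρ
  have hκ0 : 0 < ‖κ‖ := norm_pos_iff.2 (by rintro rfl; simp at hκ)
  have hκne : κ ≠ 0 := norm_pos_iff.1 hκ0
  have hwc := h.continuous
  have hw2 : ∀ x ≤ 0, ‖w x‖ ≤ 2 := fun x hx => h.norm_le_two hφ hi hκ hκ4 hx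
  have hw'2 : ∀ x ≤ 0, ‖w' x‖ ≤ 2 * N := fun x hx =>
    (h.norm_deriv_le hφ hi hκ hx).trans (integral_norm_mul_le hφ hi hw2 hx)
  have hw' : ∀ x ≤ 0, ‖w' x‖ ≤ C₁ / ‖κ‖ := by
    -- Integration by parts in differential form: `V = w' + φ w / κ` satisfies `V' = -κ V + (φ' w +
    -- φ w') / κ`, whose source has gained a factor `κ⁻¹`. The part `φ' w` is absorbed by `ρ`, the
    -- part `φ w'` by `∫ |φ|`.
    have hV : ∀ x ≤ 0, ‖w' x + φ x * w x / κ‖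
        ≤ (2 * ρ x + 2 * N * ∫ t in Iic x, |φ t|) / ‖κ‖ := fun x hx => by
      refine norm_le_of_damped_comparison hκ (V := fun x => w' x + φ x * w x / κ)
        (r := fun x => (φ' x * w x + φ x * w' x) / κ)
        (ρ := fun x => (2 * ρ x + 2 * N * ∫ t in Iic x, |φ t|) / ‖κ‖)
        (ρ' := fun x => (2 * ρ' x + 2 * N * |φ x|) / ‖κ‖) (fun t ht => ?_) ?_ (fun t ht => ?_)
        (fun t ht => ?_) (fun t ht => ?_) hx
      · refine ((h.hasDerivAt' t).add
          (((hφ' t).ofReal_comp.mul (h.hasDerivAt t)).div_const κ)).congr_deriv ?_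
        field_simp
        ring
      · have h1 : Tendsto (fun x => (φ x : ℂ)) atBot (𝓝 ((0 : ℝ) : ℂ)) :=
          (Complex.continuous_ofReal.tendsto 0).comp hφ0
        simpa using h.tendsto'.add ((h1.mul h.tendsto).div_const κ)
      · exact (((hρ t ht).1.const_mul 2).add
          ((hasDerivAt_integral_Iic hφ.abs hi.abs t).const_mul (2 * N))).div_const ‖κ‖
      · have h1 := (hρ t ht).2.1
        have h2 : 0 ≤ ∫ s in Iic t, |φ s| := integral_nonneg fun s => abs_nonneg _
        positivity
      · have h2 : 0 ≤ ∫ s in Iic t, |φ s| := integral_nonneg fun s => abs_nonneg _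
        have h3 := (hρ t ht).2.2.2
        rw [norm_div, mul_div_assoc', ← add_div]
        refine div_le_div_of_nonneg_right ?_ hκ0.le
        have h4 : ‖(φ' t : ℂ) * w t + φ t * w' t‖ ≤ |φ' t| * 2 + |φ t| * (2 * N) := by
          refine (norm_add_le _ _).trans (add_le_add ?_ ?_)
          · rw [norm_mul, Complex.norm_real, Real.norm_eq_abs]
            exact mul_le_mul_of_nonneg_left (hw2 t ht) (abs_nonneg _)
          · rw [norm_mul, Complex.norm_real, Real.norm_eq_abs]
            exact mul_le_mul_of_nonneg_left (hw'2 t ht) (abs_nonneg _)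
        have h5 : 0 ≤ κ.re * (2 * N * ∫ s in Iic t, |φ s|) := by positivity
        nlinarith
    intro x hx
    have h1 : ‖w' x‖ ≤ ‖w' x + φ x * w x / κ‖ + ‖φ x * w x / κ‖ := by
      simpa using norm_sub_le (w' x + φ x * w x / κ) (φ x * w x / κ)
    have h2 : ‖φ x * w x / κ‖ ≤ A * 2 / ‖κ‖ := by
      rw [norm_div, norm_mul, Complex.norm_real]
      have := hA x hx
      have := hw2 x hx
      have := (norm_nonneg _).trans (hA x hx)
      gcongr
    refine h1.trans ((add_le_add (hV x hx) h2).trans ?_)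
    rw [← add_div]
    refine div_le_div_of_nonneg_right ?_ hκ0.le
    have h3 : ∫ t in Iic x, |φ t| ≤ N := integral_Iic_abs_mono hφ hi hx
    have h4 := (hρ x hx).2.2.1
    rw [hC₁]
    nlinarith
  have hdiv : ∀ x, w x = 1 - ((∫ t in Iic x, φ t * w t) + w' x) / κ := fun x => by
    have := h.mul_add_eq hφ hi x
    field_simp
    linear_combination this
  have hw1 : ∀ x ≤ 0, ‖w x - 1‖ ≤ 4 * N / ‖κ‖ := fun x hx => by
    rw [show w x - 1 = -(((∫ t in Iic x, φ t * w t) + w' x) / κ) by linear_combination hdiv x,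
      norm_neg, norm_div]
    refine div_le_div_of_nonneg_right ?_ hκ0.le
    have h5 := norm_integral_le_integral_norm (μ := volume.restrict (Iic x))
      (fun s => φ s * w s)
    have h7 := integral_norm_mul_le hφ hi hw2 hx
    have h4 := norm_add_le (∫ s in Iic x, φ s * w s) (w' x)
    linarith [hw'2 x hx]
  have hiw := h.integrableOn hi
  have hiC : IntegrableOn (fun t => (φ t : ℂ)) (Iic 0) := hi.ofReal
  have hφC : Continuous fun t => (φ t : ℂ) := by fun_prop
  set H : ℝ → ℂ := fun x => ∫ t in Iic x, (φ t : ℂ) with hH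
  have hHd : ∀ x, HasDerivAt H (φ x) x := hasDerivAt_integral_Iic hφC hiC
  have hHc : Continuous H := continuous_iff_continuousAt.2 fun x => (hHd x).continuousAt
  have hH0 : Tendsto H atBot (𝓝 0) := tendsto_integral_Iic_atBot hφC hiC
  -- Second iteration: `w - 1 = O(κ⁻¹)` is fed back into the integral, and `w' / κ` is already
  -- `O(κ⁻²)`.
  have hw2' : ∀ x ≤ 0, ‖w x - 1 + H x / κ‖ ≤ (C₁ + 4 * N * N) / ‖κ‖ ^ 2 := fun x hx => by
    have e1 : ∫ t in Iic x, φ t * (w t - 1) = (∫ t in Iic x, φ t * w t) - H x := by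
      simp only [mul_sub, mul_one]
      exact integral_sub (integrableOn_Iic_of_continuous (by fun_prop) hiw x)
        (integrableOn_Iic_of_continuous hφC hiC x)
    have e2 : w x - 1 + H x / κ = -((w' x + ∫ t in Iic x, φ t * (w t - 1)) / κ) := by
      rw [e1]; linear_combination hdiv x
    rw [e2, norm_neg, norm_div, pow_two, ← div_div]
    refine div_le_div_of_nonneg_right ?_ hκ0.le
    have h5 := norm_integral_le_integral_norm (μ := volume.restrict (Iic x))
      (fun s => φ s * (w s - 1))
    have h7 := integral_norm_mul_le hφ hi hw1 hx
    have h4 := norm_add_le (w' x) (∫ s in Iic x, φ s * (w s - 1))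
    have h8 := hw' x hx
    have : (C₁ + 4 * N * N) / ‖κ‖ = C₁ / ‖κ‖ + 4 * N / ‖κ‖ * N := by ring
    linarith
  refine ⟨(hw' 0 le_rfl).trans (by gcongr; exact le_max_left _ _), ?_⟩
  have hiH : IntegrableOn (fun t => (φ t : ℂ) * H t) (Iic 0) := by
    obtain ⟨C, hC⟩ := exists_norm_le_Iic_of_tendsto hHc hH0 0
    refine Integrable.mul_bdd (c := C) hiC hHc.aestronglyMeasurable ?_
    filter_upwards [ae_restrict_mem measurableSet_Iic] with t ht using hC t ht
  -- Since `H' = φ`, the integrand is the derivative of `H² / 2`; this is the source of the term `I²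
  -- / (2κ)`.
  have hHH : ∫ t in Iic 0, (φ t : ℂ) * H t = H 0 ^ 2 / 2 := by
    have hd : ∀ t, HasDerivAt (fun t => H t ^ 2 / 2) (φ t * H t) t := fun t => by
      refine (((hHd t).pow 2).div_const 2).congr_deriv ?_
      simp
      ring
    have hl : Tendsto (fun t => H t ^ 2 / 2) atBot (𝓝 0) := by
      simpa using (hH0.pow 2).div_const 2
    rw [integral_Iic_of_hasDerivAt_of_tendsto (hd 0).continuousAt.continuousWithinAt
      (fun t _ => hd t) hiH hl, sub_zero]
  have hreal : ((∫ t in Iic 0, φ t : ℝ) : ℂ) = H 0 := integral_ofReal.symm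
  have e3 : (∫ t in Iic 0, φ t * w t) - (H 0 - H 0 ^ 2 / (2 * κ))
      = ∫ t in Iic 0, φ t * (w t - 1 + H t / κ) := by
    have : ∀ t, φ t * (w t - 1 + H t / κ) = φ t * w t - φ t + φ t * H t / κ := fun t => by ring
    simp only [this]
    have hs : IntegrableOn (fun t => φ t * w t - (φ t : ℂ)) (Iic 0) := hiw.sub hiC
    rw [integral_add hs (hiH.div_const κ), integral_sub hiw hiC, integral_div, hHH]
    simp only [hH]
    field_simp
    ring
  rw [hreal, e3]
  refine (norm_integral_le_integral_norm _).trans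
    ((integral_norm_mul_le hφ hi hw2' le_rfl).trans ?_)
  rw [div_mul_eq_mul_div]
  gcongr
  rw [← hN, mul_comm]
  exact le_max_right _ _

end IsJost

theorem exists_norm_le_of_tendsto {E : Type*} [NormedAddCommGroup E] {w : ℝ → E} {l r : E}
    (hw : Continuous w) (hl : Tendsto w atBot (𝓝 l)) (hr : Tendsto w atTop (𝓝 r)) :
    ∃ C, ∀ x, ‖w x‖ ≤ C := by
  obtain ⟨C₁, h₁⟩ := exists_norm_le_Iic_of_tendsto hw hl 0
  obtain ⟨C₂, h₂⟩ := exists_norm_le_Iic_of_tendsto (hw.comp continuous_neg)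
    (hr.comp tendsto_neg_atBot_atTop) 0
  refine ⟨max C₁ C₂, fun x => ?_⟩
  rcases le_total x 0 with h | h
  · exact (h₁ x h).trans (le_max_left _ _)
  · simpa using (h₂ (-x) (by linarith)).trans (le_max_right _ _)

/-- A solution `u` of `u'' = -c u' - f(u)` with finite limits at `±∞`. -/
structure IsFrontProfile (f : ℝ → ℝ) (c : ℝ) (u u' : ℝ → ℝ) (um up : ℝ) : Prop where
  hasDerivAt : ∀ x, HasDerivAt u (u' x) x
  hasDerivAt' : ∀ x, HasDerivAt u' (-c * u' x - f (u x)) x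
  tendsto_atBot : Tendsto u atBot (𝓝 um)
  tendsto_atTop : Tendsto u atTop (𝓝 up)

theorem IsTravellingWave.isFrontProfile {f u : ℝ → ℝ} {c um up : ℝ} (hu : IsTravellingWave f c u)
    (hum : Tendsto u atBot (𝓝 um)) (hup : Tendsto u atTop (𝓝 up)) :
    IsFrontProfile f c u (deriv u) um up := by
  obtain ⟨hu2, hpde⟩ := hu
  have hd : Differentiable ℝ u := hu2.differentiable (by norm_num)
  have hd' : Differentiable ℝ (deriv u) := by
    have : ContDiff ℝ (1 + 1) u := by simpa [one_add_one_eq_two] using hu2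
    exact (contDiff_succ_iff_deriv.1 this).2.2.differentiable (by norm_num)
  refine ⟨fun x => (hd x).hasDerivAt, fun x => ?_, hum, hup⟩
  refine (hd' x).hasDerivAt.congr_deriv ?_
  have h1 : HasDerivAt (fun s : ℝ => u (x - c * s)) (deriv u x * -c) 0 := by
    have h2 : HasDerivAt (fun s : ℝ => x - c * s) (-c) 0 := by
      simpa using ((hasDerivAt_id (0 : ℝ)).const_mul c).const_sub x
    have h3 : HasDerivAt u (deriv u x) (x - c * 0) := by simpa using (hd x).hasDerivAt
    exact h3.comp (0 : ℝ) h2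
  have h := hpde x 0
  rw [h1.deriv] at h
  simp only [mul_zero, sub_zero, iteratedDeriv_succ, iteratedDeriv_zero] at h
  linarith

/-! ### The profile: bounded derivative, and finite variation when `c = 0`. -/

namespace IsFrontProfile

variable {f u u' : ℝ → ℝ} {c um up : ℝ}

theorem reflect (h : IsFrontProfile f c u u' um up) :
    IsFrontProfile f (-c) (fun x => u (-x)) (fun x => -u' (-x)) up um := by
  refine ⟨fun x => ?_, fun x => ?_, h.tendsto_atTop.comp tendsto_neg_atBot_atTop,
    h.tendsto_atBot.comp tendsto_neg_atTop_atBot⟩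
  · exact ((h.hasDerivAt (-x)).comp x (hasDerivAt_neg x)).congr_deriv (by ring)
  · exact ((h.hasDerivAt' (-x)).comp x (hasDerivAt_neg x)).neg.congr_deriv (by ring)

theorem continuous (h : IsFrontProfile f c u u' um up) : Continuous u :=
  continuous_iff_continuousAt.2 fun x => (h.hasDerivAt x).continuousAt

theorem continuous' (h : IsFrontProfile f c u u' um up) : Continuous u' :=
  continuous_iff_continuousAt.2 fun x => (h.hasDerivAt' x).continuousAt

theorem exists_norm_comp_le (h : IsFrontProfile f c u u' um up) {g : ℝ → ℝ} (hg : Continuous g) :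
    ∃ C, ∀ x, ‖g (u x)‖ ≤ C :=
  exists_norm_le_of_tendsto (hg.comp h.continuous) ((hg.tendsto um).comp h.tendsto_atBot)
    ((hg.tendsto up).comp h.tendsto_atTop)

/-- The mean value theorem provides in each `(x, x + 1)` a point where `u'` is at most `2M`. The
bound is carried back to `x` because `u' + c u` has the bounded derivative `-f(u)`. -/
theorem exists_deriv_le (h : IsFrontProfile f c u u' um up) (hf : Continuous f) :
    ∃ C, ∀ x, ‖u' x‖ ≤ C := by
  obtain ⟨M, hM⟩ := h.exists_norm_comp_le continuous_id
  obtain ⟨F, hF⟩ := h.exists_norm_comp_le hf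
  simp only [Real.norm_eq_abs, id] at hM hF ⊢
  refine ⟨2 * M + 2 * (|c| * M) + F, fun x => ?_⟩
  obtain ⟨a, ha, hau⟩ := exists_hasDerivAt_eq_slope u u' (lt_add_one x)
    h.continuous.continuousOn (fun t _ => h.hasDerivAt t)
  have h1 : |u' a| ≤ 2 * M := by
    rw [hau, add_sub_cancel_left, div_one]
    exact (abs_sub _ _).trans (by linarith [hM (x + 1), hM x])
  have hd : ∀ t, HasDerivAt (fun t => u' t + c * u t) (-f (u t)) t := fun t =>
    ((h.hasDerivAt' t).add ((h.hasDerivAt t).const_mul c)).congr_deriv (by ring)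
  have h2 := norm_image_sub_le_of_norm_deriv_le_segment' (a := x) (b := a) (C := F)
    (fun t _ => (hd t).hasDerivWithinAt) (fun t _ => by simpa using hF t) a
    (right_mem_Icc.2 ha.1.le)
  simp only [Real.norm_eq_abs] at h2
  have hF0 : 0 ≤ F := (abs_nonneg _).trans (hF 0)
  have h3 : F * (a - x) ≤ F := mul_le_of_le_one_right hF0 (by linarith [ha.2])
  have h4 : ∀ t, |c * u t| ≤ |c| * M := fun t => by
    rw [abs_mul]; exact mul_le_mul_of_nonneg_left (hM t) (abs_nonneg c)
  have h5 := h4 a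
  have h6 := h4 x
  rw [abs_le] at *
  constructor <;> linarith

/-- For `c = 0` the equation is reversible, so `u(2a - t)` solves it too, with the same data at `t =
a` when `u'(a) = 0`. -/
theorem eq_reflect_of_deriv_eq_zero (h : IsFrontProfile f 0 u u' um up) (hf : ContDiff ℝ 1 f)
    {a : ℝ} (ha : u' a = 0) (t : ℝ) : u (2 * a - t) = u t := by
  obtain ⟨M, hM⟩ := h.exists_norm_comp_le continuous_id
  obtain ⟨M', hM'⟩ := h.exists_deriv_le hf.continuous
  simp only [Real.norm_eq_abs, id, abs_le] at hM hM'
  have hv : ContDiff ℝ 1 fun p : ℝ × ℝ => (p.2, -f p.1) := by fun_prop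
  -- The vector field is only locally Lipschitz; both orbits stay in this compact box, so ODE
  -- uniqueness applies there.
  obtain ⟨K, hK⟩ := LocallyLipschitzOn.exists_lipschitzOnWith_of_compact
    (isCompact_Icc.prod isCompact_Icc : IsCompact (Icc (-M) M ×ˢ Icc (-M') M'))
    hv.locallyLipschitz.locallyLipschitzOn
  have hd : ∀ t, HasDerivAt (fun t => (u t, u' t)) (u' t, -f (u t)) t := fun t =>
    ((h.hasDerivAt t).prodMk (h.hasDerivAt' t)).congr_deriv (by simp)
  have hr : ∀ t, HasDerivAt (fun t => 2 * a - t) (-1) t := fun t =>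
    (hasDerivAt_id t).const_sub (2 * a)
  have hd' : ∀ t, HasDerivAt (fun t => (u (2 * a - t), -u' (2 * a - t)))
      (-u' (2 * a - t), -f (u (2 * a - t))) t := fun t => by
    refine (((h.hasDerivAt (2 * a - t)).comp t (hr t)).prodMk
      ((h.hasDerivAt' (2 * a - t)).comp t (hr t)).neg).congr_deriv ?_
    simp
  have := ODE_solution_unique_univ (v := fun _ p => (p.2, -f p.1)) (t₀ := a)
    (f := fun t => (u (2 * a - t), -u' (2 * a - t))) (g := fun t => (u t, u' t))
    (fun _ => hK) (fun t => ⟨hd' t, hM _, by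
      have := hM' (2 * a - t); constructor <;> simp only <;> linarith⟩)
    (fun t => ⟨hd t, hM _, hM' _⟩)
    (by simp [two_mul, ha])
  exact congrArg Prod.fst (congrFun this t)

/-- The reflections about `a` and `b` compose to a translation by `2(b - a)`. A periodic function
with a limit at `+∞` is constant. -/
theorem deriv_eq_zero_of_two_zeros (h : IsFrontProfile f 0 u u' um up) (hf : ContDiff ℝ 1 f)
    {a b : ℝ} (hab : a < b) (ha : u' a = 0) (hb : u' b = 0) (x : ℝ) : u' x = 0 := by
  have hper : Function.Periodic u (2 * (b - a)) := fun t => by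
    rw [← h.eq_reflect_of_deriv_eq_zero hf ha t,
      ← h.eq_reflect_of_deriv_eq_zero hf hb (2 * a - t)]
    ring_nf
  have hconst : ∀ t, u t = up := fun t => by
    have h1 : Tendsto (fun n : ℕ => t + n * (2 * (b - a))) atTop atTop :=
      tendsto_atTop_add_const_left _ _
        (tendsto_natCast_atTop_atTop.atTop_mul_const (by linarith))
    refine tendsto_nhds_unique ?_ (h.tendsto_atTop.comp h1)
    refine tendsto_const_nhds.congr fun n => ?_
    simpa using (hper.nat_mul n t).symm
  have h2 := h.hasDerivAt x
  rw [funext hconst] at h2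
  exact h2.unique (hasDerivAt_const x up)

/-- By Darboux's property `u'` has one sign on the interval, so the integral telescopes. -/
theorem integral_abs_deriv_le_of_ne_zero (h : IsFrontProfile f c u u' um up) {M : ℝ}
    (hM : ∀ x, |u x| ≤ M) {a b : ℝ} (hab : a ≤ b) (hne : ∀ x ∈ Ioo a b, u' x ≠ 0) :
    ∫ t in a..b, |u' t| ≤ 2 * M := by
  have hFTC : ∫ t in a..b, u' t = u b - u a :=
    intervalIntegral.integral_eq_sub_of_hasDerivAt (fun x _ => h.hasDerivAt x)
      (h.continuous'.intervalIntegrable _ _)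
  have hb := abs_le.1 (hM b)
  have ha := abs_le.1 (hM a)
  rcases hasDerivWithinAt_forall_lt_or_forall_gt_of_forall_ne (convex_Ioo a b)
    (fun x _ => (h.hasDerivAt x).hasDerivWithinAt) hne with hs | hs
  · rw [intervalIntegral.integral_congr_Ioo_of_le (g := fun t => -u' t) hab
      (fun t ht => abs_of_neg (hs t ht)), intervalIntegral.integral_neg, hFTC]
    linarith
  · rw [intervalIntegral.integral_congr_Ioo_of_le (g := u') hab
      (fun t ht => abs_of_pos (hs t ht)), hFTC]
    linarith

theorem integral_abs_deriv_le (h : IsFrontProfile f 0 u u' um up) (hf : ContDiff ℝ 1 f) {M : ℝ}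
    (hM : ∀ x, |u x| ≤ M) {a b : ℝ} (hab : a ≤ b) : ∫ t in a..b, |u' t| ≤ 4 * M := by
  have hM0 : 0 ≤ M := (abs_nonneg _).trans (hM 0)
  by_cases hz : ∃ s ∈ Ioo a b, u' s = 0
  · obtain ⟨s, hs, hs0⟩ := hz
    by_cases hz' : ∃ r, r ≠ s ∧ u' r = 0
    · obtain ⟨r, hrs, hr0⟩ := hz'
      have h0 : ∀ x, u' x = 0 := by
        rcases lt_or_gt_of_ne hrs with hlt | hlt
        · exact h.deriv_eq_zero_of_two_zeros hf hlt hr0 hs0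
        · exact h.deriv_eq_zero_of_two_zeros hf hlt hs0 hr0
      simp only [h0, abs_zero, intervalIntegral.integral_zero]
      linarith
    · push Not at hz'
      have hi := h.continuous'.abs.intervalIntegrable (μ := volume)
      rw [← intervalIntegral.integral_add_adjacent_intervals (hi a s) (hi s b)]
      have h1 := h.integral_abs_deriv_le_of_ne_zero hM hs.1.le fun x hx => hz' x hx.2.ne
      have h2 := h.integral_abs_deriv_le_of_ne_zero hM hs.2.le fun x hx => hz' x hx.1.ne'
      linarith
  · push Not at hz
    linarith [h.integral_abs_deriv_le_of_ne_zero hM hab hz]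

/-- A bounded comparison function dominating the derivative of `f' ∘ u`. -/
theorem exists_comparison (h : IsFrontProfile f c u u' um up) (hf : ContDiff ℝ 1 f)
    {g : ℝ → ℝ} (hg : Continuous g) :
    ∃ B, ∀ k : ℝ, |c| ≤ k → ∃ ρ ρ' : ℝ → ℝ, ∀ x ≤ 0, HasDerivAt ρ (ρ' x) x ∧ 0 ≤ ρ x ∧
      ρ x ≤ B ∧ |g (u x) * u' x| ≤ ρ' x + k * ρ x := by
  obtain ⟨G, hG⟩ := h.exists_norm_comp_le hg
  obtain ⟨U, hU⟩ := h.exists_deriv_le hf.continuous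
  simp only [Real.norm_eq_abs] at hG hU
  have hG0 : 0 ≤ G := (abs_nonneg _).trans (hG 0)
  have hU0 : 0 ≤ U := (abs_nonneg _).trans (hU 0)
  by_cases hc : c = 0
  · subst hc
    obtain ⟨M, hM⟩ := h.exists_norm_comp_le continuous_id
    simp only [Real.norm_eq_abs, id] at hM
    have hu' := h.continuous'
    -- Here `k` may be arbitrarily small, so `ρ'` alone must dominate. The integral is negative for
    -- `x < 0`; adding `4M`, the bound on the total variation, makes `ρ` nonnegative.
    refine ⟨G * (4 * M), fun k hk => ⟨fun x => G * ((∫ t in (0 : ℝ)..x, |u' t|) + 4 * M),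
      fun x => G * |u' x|, fun x hx => ?_⟩⟩
    have h1 : ∫ t in x..0, |u' t| ≤ 4 * M := h.integral_abs_deriv_le hf hM hx
    have h2 : 0 ≤ ∫ t in x..0, |u' t| :=
      intervalIntegral.integral_nonneg hx fun t _ => abs_nonneg _
    rw [intervalIntegral.integral_symm] at h1 h2
    have h3 : 0 ≤ G * ((∫ t in (0 : ℝ)..x, |u' t|) + 4 * M) := mul_nonneg hG0 (by linarith)
    refine ⟨?_, h3, mul_le_mul_of_nonneg_left (by linarith) hG0, ?_⟩
    · exact ((hu'.abs.integral_hasStrictDerivAt 0 x).hasDerivAt.add_const _).const_mul G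
    · rw [abs_mul]
      rw [abs_zero] at hk
      have := mul_le_mul_of_nonneg_right (hG x) (abs_nonneg (u' x))
      have := mul_nonneg hk h3
      linarith
  · have hc0 : 0 < |c| := abs_pos.2 hc
    -- With damping at least `|c| > 0` a constant `ρ` suffices.
    refine ⟨G * U / |c|, fun k hk => ⟨fun _ => G * U / |c|, fun _ => 0, fun x _ =>
      ⟨hasDerivAt_const _ _, by positivity, le_rfl, ?_⟩⟩⟩
    rw [abs_mul, zero_add]
    calc |g (u x)| * |u' x| ≤ G * U := mul_le_mul (hG x) (hU x) (abs_nonneg _) hG0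
      _ = |c| * (G * U / |c|) := by field_simp
      _ ≤ k * (G * U / |c|) := mul_le_mul_of_nonneg_right hk (by positivity)

end IsFrontProfile

/-! ### Solutions of the first-order system: uniqueness and exponential form. -/

section EvansSolutions

variable {f u : ℝ → ℝ} {c q : ℝ} {z μ : ℂ}

theorem isEvansSolution_iff {y : ℝ → Fin 2 → ℂ} :
    IsEvansSolution f c u z y ↔ ∀ ξ, HasDerivAt (fun x => y x 0) (y ξ 1) ξ ∧
      HasDerivAt (fun x => y x 1)
        ((z - ((deriv f (u ξ) : ℝ) : ℂ)) * y ξ 0 - c * y ξ 1) ξ := by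
  refine forall_congr' fun ξ => ?_
  rw [hasDerivAt_pi, Fin.forall_fin_two]
  simp [evansMatrix, Matrix.mulVec, dotProduct, Fin.sum_univ_two, sub_eq_add_neg]

theorem IsEvansSolution.eq_of_eq_zero {y₁ y₂ : ℝ → Fin 2 → ℂ} {B : ℝ}
    (hB : ∀ x, |deriv f (u x)| ≤ B)
    (h₁ : IsEvansSolution f c u z y₁) (h₂ : IsEvansSolution f c u z y₂) (h0 : y₁ 0 = y₂ 0) :
    y₁ = y₂ := by
  have hB0 : 0 ≤ B := (abs_nonneg _).trans (hB 0)
  have hL : ∀ t, LipschitzWith (Real.toNNReal (1 + ‖z‖ + B + |c|))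
      fun y : Fin 2 → ℂ => (evansMatrix f c u z t).mulVec y := fun t => by
    refine LipschitzWith.of_dist_le_mul fun a b => ?_
    rw [dist_eq_norm, dist_eq_norm, ← Matrix.mulVec_sub, Real.coe_toNNReal _ (by positivity)]
    set d := a - b
    have hd : ∀ i, ‖d i‖ ≤ ‖d‖ := norm_le_pi_norm d
    refine (pi_norm_le_iff_of_nonneg (by positivity)).2 (Fin.forall_fin_two.2 ⟨?_, ?_⟩)
    · simp only [evansMatrix, Matrix.mulVec, dotProduct, Fin.sum_univ_two]
      simp only [Matrix.of_apply, Matrix.cons_val', Matrix.cons_val_zero, Matrix.cons_val_one,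
        zero_mul, one_mul, zero_add]
      refine (hd 1).trans (le_mul_of_one_le_left (norm_nonneg _) ?_)
      linarith [norm_nonneg z, abs_nonneg c]
    · simp only [evansMatrix, Matrix.mulVec, dotProduct, Fin.sum_univ_two]
      simp only [Matrix.of_apply, Matrix.cons_val', Matrix.cons_val_zero, Matrix.cons_val_one]
      have h1 : ‖(z - ((deriv f (u t) : ℝ) : ℂ)) * d 0‖ ≤ (‖z‖ + B) * ‖d‖ := by
        rw [norm_mul]
        refine mul_le_mul ((norm_sub_le _ _).trans (add_le_add le_rfl ?_)) (hd 0)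
          (norm_nonneg _) (by positivity)
        simpa using hB t
      have h2 : ‖-(c : ℂ) * d 1‖ ≤ |c| * ‖d‖ := by
        rw [norm_mul, norm_neg, Complex.norm_real, Real.norm_eq_abs]
        exact mul_le_mul_of_nonneg_left (hd 1) (abs_nonneg c)
      refine (norm_add_le _ _).trans ?_
      linarith [norm_nonneg d]
  exact ODE_solution_unique_univ (v := fun t y => (evansMatrix f c u z t).mulVec y)
    (s := fun _ => univ) (t₀ := 0) (fun t => (hL t).lipschitzOnWith)
    (fun t => ⟨h₁ t, mem_univ _⟩) (fun t => ⟨h₂ t, mem_univ _⟩) h0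

/-- By constancy of the rescaled Wronskian, solutions with the same dominated exponential
asymptotics coincide. -/
theorem IsEvansSolution.eq_of_tendsto {y₁ y₂ : ℝ → Fin 2 → ℂ} {B : ℝ} {F : Filter ℝ} [F.NeBot]
    (hB : ∀ x, |deriv f (u x)| ≤ B) (hF : ∀ᶠ ξ : ℝ in F, 0 ≤ -((2 * μ + c).re * ξ))
    (h₁ : IsEvansSolution f c u z y₁) (h₂ : IsEvansSolution f c u z y₂)
    (l₁ : Tendsto (fun ξ : ℝ => Complex.exp (-(μ * (ξ : ℂ))) • y₁ ξ) F (𝓝 ![1, μ]))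
    (l₂ : Tendsto (fun ξ : ℝ => Complex.exp (-(μ * (ξ : ℂ))) • y₂ ξ) F (𝓝 ![1, μ])) :
    y₁ = y₂ := by
  have e₁ := isEvansSolution_iff.1 h₁
  have e₂ := isEvansSolution_iff.1 h₂
  set W : ℝ → ℂ := fun x => y₁ x 0 * y₂ x 1 - y₁ x 1 * y₂ x 0 with hW
  have hWd : ∀ x : ℝ, HasDerivAt (fun x : ℝ => Complex.exp (c * x) * W x) 0 x := fun x => by
    have h1 : HasDerivAt (fun x : ℝ => (c : ℂ) * (x : ℂ)) c x := by
      simpa using ((hasDerivAt_id x).ofReal_comp).const_mul (c : ℂ)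
    refine (h1.cexp.mul (((e₁ x).1.mul (e₂ x).2).sub ((e₁ x).2.mul (e₂ x).1))).congr_deriv ?_
    simp only [Pi.sub_apply, Pi.mul_apply]
    ring
  have hWc : ∀ x : ℝ, Complex.exp (c * x) * W x = W 0 := fun x => by
    have := is_const_of_deriv_eq_zero (fun x => (hWd x).differentiableAt)
      (fun x => (hWd x).deriv) x 0
    simpa using this
  have hlim : ∀ {y : ℝ → Fin 2 → ℂ},
      Tendsto (fun ξ : ℝ => Complex.exp (-(μ * (ξ : ℂ))) • y ξ) F (𝓝 ![1, μ]) →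
      Tendsto (fun ξ : ℝ => Complex.exp (-(μ * (ξ : ℂ))) * y ξ 0) F (𝓝 1) ∧
      Tendsto (fun ξ : ℝ => Complex.exp (-(μ * (ξ : ℂ))) * y ξ 1) F (𝓝 μ) := fun h => by
    simpa [tendsto_pi_nhds, Fin.forall_fin_two] using h
  obtain ⟨l₁0, l₁1⟩ := hlim l₁
  obtain ⟨l₂0, l₂1⟩ := hlim l₂
  -- The rescaled Wronskian tends to `1 * μ - μ * 1 = 0`, yet it equals `e^{-(2μ+c)ξ} W(0)`, whose
  -- modulus is at least `‖W 0‖` along `F`.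
  have hW0 : W 0 = 0 := by
    have hl := ((l₁0.mul l₂1).sub (l₁1.mul l₂0)).norm
    rw [one_mul, mul_one, sub_self, norm_zero] at hl
    refine norm_le_zero_iff.1 (ge_of_tendsto hl ?_)
    filter_upwards [hF] with ξ hξ
    have : Complex.exp (-(μ * ξ)) * y₁ ξ 0 * (Complex.exp (-(μ * ξ)) * y₂ ξ 1) -
        Complex.exp (-(μ * ξ)) * y₁ ξ 1 * (Complex.exp (-(μ * ξ)) * y₂ ξ 0)
        = Complex.exp (-(2 * μ + c) * ξ) * W 0 := by
      have hexp : Complex.exp (-(2 * μ + c) * ξ) * Complex.exp (c * ξ)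
          = Complex.exp (-(μ * ξ)) * Complex.exp (-(μ * ξ)) := by
        rw [← Complex.exp_add, ← Complex.exp_add]
        ring_nf
      rw [← hWc ξ]
      simp only [hW]
      linear_combination -(y₁ ξ 0 * y₂ ξ 1 - y₁ ξ 1 * y₂ ξ 0) * hexp
    rw [this, norm_mul, norm_exp_mul_ofReal, Complex.neg_re]
    exact le_mul_of_one_le_left (norm_nonneg _) (Real.one_le_exp (by linarith))
  have hne : y₁ 0 ≠ 0 := fun h => by
    have hz : IsEvansSolution f c u z 0 := isEvansSolution_iff.2 fun ξ => by
      simpa using hasDerivAt_const ξ (0 : ℂ)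
    have := h₁.eq_of_eq_zero hB hz h
    subst this
    simp at l₁0
  obtain ⟨α, hα⟩ : ∃ α : ℂ, y₂ 0 = α • y₁ 0 := by
    have hW0' : y₁ 0 0 * y₂ 0 1 = y₁ 0 1 * y₂ 0 0 := sub_eq_zero.1 hW0
    by_cases h : y₁ 0 0 = 0
    · have h' : y₁ 0 1 ≠ 0 := fun h' => hne (by ext i; fin_cases i <;> assumption)
      refine ⟨y₂ 0 1 / y₁ 0 1, ?_⟩
      ext i
      fin_cases i
      · rw [h, zero_mul] at hW0'
        simpa [h, h'] using hW0'.symm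
      · simp [h']
    · refine ⟨y₂ 0 0 / y₁ 0 0, ?_⟩
      ext i
      fin_cases i
      · simp [h]
      · simp only [Fin.mk_one, Pi.smul_apply, smul_eq_mul]
        field_simp
        linear_combination hW0'
  have hs : IsEvansSolution f c u z (α • y₁) := isEvansSolution_iff.2 fun ξ => by
    refine ⟨(e₁ ξ).1.const_mul α, ((e₁ ξ).2.const_mul α).congr_deriv ?_⟩
    simp only [Pi.smul_apply, smul_eq_mul]
    ring
  have heq : y₂ = α • y₁ := h₂.eq_of_eq_zero hB hs hα
  have hα1 : α = 1 := by
    have h1 := l₁0.const_mul α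
    rw [mul_one] at h1
    refine tendsto_nhds_unique (h1.congr fun ξ => ?_) l₂0
    rw [heq]
    simp only [Pi.smul_apply, smul_eq_mul]
    ring
  rw [heq, hα1, one_smul]

/-- The solution of the first-order system with first component `e^{μ ξ} w(ξ)`. -/
noncomputable def expSolution (μ : ℂ) (w w' : ℝ → ℂ) (ξ : ℝ) : Fin 2 → ℂ :=
  Complex.exp (μ * ξ) • ![w ξ, μ * w ξ + w' ξ]

theorem isEvansSolution_expSolution {w w' : ℝ → ℂ}
    (hμ : μ ^ 2 + c * μ = z - ((deriv f q : ℝ) : ℂ)) (hw : ∀ x, HasDerivAt w (w' x) x)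
    (hw' : ∀ x, HasDerivAt w' (-(2 * μ + c) * w' x - evansPhi f u q x * w x) x) :
    IsEvansSolution f c u z (expSolution μ w w') := by
  refine isEvansSolution_iff.2 fun ξ => ?_
  have h1 : HasDerivAt (fun x : ℝ => μ * (x : ℂ)) μ ξ := by
    simpa using ((hasDerivAt_id ξ).ofReal_comp).const_mul μ
  have hz : z = μ ^ 2 + c * μ + ((deriv f q : ℝ) : ℂ) := by rw [hμ]; ring
  simp only [expSolution, Pi.smul_apply, smul_eq_mul, Matrix.cons_val_zero, Matrix.cons_val_one]
  refine ⟨(h1.cexp.mul (hw ξ)).congr_deriv (by ring),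
    (h1.cexp.mul (((hw ξ).const_mul μ).add (hw' ξ))).congr_deriv ?_⟩
  rw [hz]
  simp only [evansPhi, Pi.add_apply]
  push_cast
  ring

theorem tendsto_expSolution {w w' : ℝ → ℂ} {F : Filter ℝ} (hw : Tendsto w F (𝓝 1))
    (hw' : Tendsto w' F (𝓝 0)) :
    Tendsto (fun ξ : ℝ => Complex.exp (-(μ * (ξ : ℂ))) • expSolution μ w w' ξ) F
      (𝓝 ![1, μ]) := by
  have h : ∀ ξ : ℝ, Complex.exp (-(μ * (ξ : ℂ))) • expSolution μ w w' ξ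
      = ![w ξ, μ * w ξ + w' ξ] := fun ξ => by
    rw [expSolution, smul_smul, ← Complex.exp_add, neg_add_cancel, Complex.exp_zero, one_smul]
  simp only [h, tendsto_pi_nhds, Fin.forall_fin_two]
  exact ⟨by simpa using hw, by simpa using (hw.const_mul μ).add hw'⟩

end EvansSolutions

/-! ### Spectral data, the set `Ω`, and the determinant in terms of `w` and `v`. -/

section Spectral

variable {f u : ℝ → ℝ} {c q um up : ℝ} {z : ℂ}

theorem evansKappa_sq (f : ℝ → ℝ) (c q : ℝ) (z : ℂ) :
    evansKappa f c q z ^ 2 = (c : ℂ) ^ 2 + 4 * (z - ((deriv f q : ℝ) : ℂ)) := by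
  rw [evansKappa, one_div]
  exact Complex.cpow_nat_inv_pow _ two_ne_zero

theorem evansMu1_quadratic :
    evansMu1 f c q z ^ 2 + c * evansMu1 f c q z = z - ((deriv f q : ℝ) : ℂ) := by
  rw [evansMu1]
  linear_combination (1 / 4 : ℂ) * evansKappa_sq f c q z

theorem evansMu2_quadratic :
    evansMu2 f c q z ^ 2 + c * evansMu2 f c q z = z - ((deriv f q : ℝ) : ℂ) := by
  rw [evansMu2]
  linear_combination (1 / 4 : ℂ) * evansKappa_sq f c q z

theorem two_mul_evansMu1_add : 2 * evansMu1 f c q z + c = evansKappa f c q z := by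
  rw [evansMu1]; ring

theorem two_mul_evansMu2_add : 2 * evansMu2 f c q z + c = -evansKappa f c q z := by
  rw [evansMu2]; ring

/-- The sign conditions on the two eigenvalues amount to `Re κ > c` and `Re κ > -c`. This is the
damping rate required by `IsFrontProfile.exists_comparison`. -/
theorem abs_lt_re_evansKappa (hz : z ∈ evansDomain f c um up) :
    |c| < (evansKappa f c um z).re ∧ |c| < (evansKappa f c up z).re := by
  obtain ⟨h1, h2, h3, h4⟩ := hz
  have e1 := congrArg Complex.re (two_mul_evansMu1_add (f := f) (c := c) (q := um) (z := z))
  have e2 := congrArg Complex.re (two_mul_evansMu2_add (f := f) (c := c) (q := um) (z := z))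
  have e3 := congrArg Complex.re (two_mul_evansMu1_add (f := f) (c := c) (q := up) (z := z))
  have e4 := congrArg Complex.re (two_mul_evansMu2_add (f := f) (c := c) (q := up) (z := z))
  simp at e1 e2 e3 e4
  constructor <;> rw [abs_lt] <;> constructor <;> linarith

theorem isLeftSolution_expSolution {w w' : ℝ → ℂ}
    (h : IsJost (evansPhi f u um) (evansKappa f c um z) w w') :
    IsLeftSolution f c u um z (expSolution (evansMu1 f c um z) w w') :=
  ⟨isEvansSolution_expSolution evansMu1_quadratic h.hasDerivAt fun x => by
    rw [two_mul_evansMu1_add]; exact h.hasDerivAt' x, tendsto_expSolution h.tendsto h.tendsto'⟩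

theorem isRightSolution_expSolution {w w' : ℝ → ℂ}
    (h : IsJost (evansPhi f (fun x => u (-x)) up) (evansKappa f c up z) w w') :
    IsRightSolution f c u up z
      (expSolution (evansMu2 f c up z) (fun x => w (-x)) (fun x => -w' (-x))) := by
  refine ⟨isEvansSolution_expSolution (q := up) evansMu2_quadratic (fun x => ?_) fun x => ?_,
    tendsto_expSolution (h.tendsto.comp tendsto_neg_atTop_atBot) ?_⟩
  · exact ((h.hasDerivAt (-x)).scomp x (hasDerivAt_neg x)).congr_deriv (by simp)
  · rw [two_mul_evansMu2_add]
    refine ((h.hasDerivAt' (-x)).scomp x (hasDerivAt_neg x)).neg.congr_deriv ?_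
    simp [evansPhi]
    ring
  · simpa using (h.tendsto'.comp tendsto_neg_atTop_atBot).neg

theorem IsLeftSolution.unique {B : ℝ} (hB : ∀ x, |deriv f (u x)| ≤ B)
    (hz : z ∈ evansDomain f c um up) {y₁ y₂ : ℝ → Fin 2 → ℂ}
    (h₁ : IsLeftSolution f c u um z y₁) (h₂ : IsLeftSolution f c u um z y₂) : y₁ = y₂ := by
  refine h₁.1.eq_of_tendsto hB ?_ h₂.1 h₁.2 h₂.2
  filter_upwards [eventually_le_atBot 0] with ξ hξ
  rw [two_mul_evansMu1_add]
  have := (abs_nonneg c).trans (abs_lt_re_evansKappa hz).1.le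
  nlinarith

theorem IsRightSolution.unique {B : ℝ} (hB : ∀ x, |deriv f (u x)| ≤ B)
    (hz : z ∈ evansDomain f c um up) {y₁ y₂ : ℝ → Fin 2 → ℂ}
    (h₁ : IsRightSolution f c u up z y₁) (h₂ : IsRightSolution f c u up z y₂) : y₁ = y₂ := by
  refine h₁.1.eq_of_tendsto hB ?_ h₂.1 h₁.2 h₂.2
  filter_upwards [eventually_ge_atTop 0] with ξ hξ
  rw [two_mul_evansMu2_add, Complex.neg_re]
  have := (abs_nonneg c).trans (abs_lt_re_evansKappa hz).2.le
  nlinarith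

/-- Uniqueness identifies the chosen `y₋`, `y₊` with the exponential solutions built from `w` and
`v`. The derivative of `v` enters with reversed sign because of the reflection. -/
theorem evansFunction_eq {B : ℝ} (hB : ∀ x, |deriv f (u x)| ≤ B)
    (hz : z ∈ evansDomain f c um up) {w w' v v' : ℝ → ℂ}
    (hw : IsJost (evansPhi f u um) (evansKappa f c um z) w w')
    (hv : IsJost (evansPhi f (fun x => u (-x)) up) (evansKappa f c up z) v v') :
    evansFunction f c u um up z =
      -(evansKappa f c um z + evansKappa f c up z) / 2 * w 0 * v 0 - w 0 * v' 0 - v 0 * w' 0 := by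
  have hl := isLeftSolution_expSolution hw
  have hr := isRightSolution_expSolution hv
  have e1 : evansLeft f c u um z = _ :=
    IsLeftSolution.unique hB hz (Classical.epsilon_spec ⟨_, hl⟩) hl
  have e2 : evansRight f c u up z = _ :=
    IsRightSolution.unique hB hz (Classical.epsilon_spec ⟨_, hr⟩) hr
  rw [evansFunction, e1, e2, Matrix.det_fin_two_of]
  simp only [expSolution, Complex.ofReal_zero, mul_zero, Complex.exp_zero, one_smul, neg_zero,
    Matrix.cons_val_zero, Matrix.cons_val_one, evansMu1, evansMu2]
  ring

end Spectral

/-! ### Principal square roots. -/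

section SquareRoots

theorem re_cpow_half_nonneg (z : ℂ) : 0 ≤ (z ^ (1 / 2 : ℂ)).re := by
  by_cases hz : z = 0
  · simp [hz]
  rw [Complex.cpow_def_of_ne_zero hz, Complex.exp_re]
  refine mul_nonneg (Real.exp_pos _).le (Real.cos_nonneg_of_mem_Icc ?_)
  have h : (Complex.log z * (1 / 2)).im = z.arg / 2 := by
    simp [Complex.mul_im, Complex.log_im, div_eq_mul_inv]
  rw [h]
  constructor <;> linarith [Complex.neg_pi_lt_arg z, Complex.arg_le_pi z]

theorem cpow_half_sq (z : ℂ) : (z ^ (1 / 2 : ℂ)) ^ 2 = z := by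
  rw [one_div]
  exact Complex.cpow_nat_inv_pow z two_ne_zero

theorem tendsto_norm_cpow_half :
    Tendsto (fun z : ℂ => ‖z ^ (1 / 2 : ℂ)‖) (Bornology.cobounded ℂ) atTop := by
  refine (Real.tendsto_sqrt_atTop.comp tendsto_norm_cobounded_atTop).congr fun z => ?_
  rw [Function.comp_apply, ← Real.sqrt_sq (norm_nonneg (z ^ (1 / 2 : ℂ))), ← norm_pow,
    cpow_half_sq]

/-- Equal imaginary parts of the squares and nonnegative real parts force `κ.im * s.im ≥ 0`. Hence
`κ` and `2s` have nonnegative real inner product and cannot cancel, even near the branch cut. -/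
theorem two_mul_norm_le_norm_add {κ s : ℂ} (hκ : 0 < κ.re) (hs : 0 ≤ s.re)
    (h : (κ ^ 2).im = (4 * s ^ 2).im) : 2 * ‖s‖ ≤ ‖κ + 2 * s‖ := by
  have h1 : κ.re * κ.im = 4 * (s.re * s.im) := by
    simp [pow_two, Complex.mul_im] at h
    linarith
  have h2 : 0 ≤ κ.im * s.im := by
    refine nonneg_of_mul_nonneg_right (?_ : 0 ≤ κ.re * (κ.im * s.im)) hκ
    rw [← mul_assoc, h1]
    nlinarith [mul_nonneg hs (sq_nonneg s.im)]
  refine (pow_le_pow_iff_left₀ (by positivity) (norm_nonneg _) two_ne_zero).1 ?_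
  rw [mul_pow, Complex.sq_norm, Complex.sq_norm, Complex.normSq_apply, Complex.normSq_apply]
  simp
  nlinarith [mul_nonneg hκ.le hs, sq_nonneg κ.re, sq_nonneg κ.im]

end SquareRoots

/-! ### Expansions in powers of `1 / s`, where `s` stands for `λ^{1/2}`. -/

section Expansions

theorem norm_le_of_sq_eq {κ s e : ℂ} (h : κ ^ 2 = 4 * s ^ 2 + e) (he : ‖e‖ ≤ 2 * ‖s‖ ^ 2) :
    ‖s‖ ≤ ‖κ‖ := by
  refine (pow_le_pow_iff_left₀ (norm_nonneg _) (norm_nonneg _) two_ne_zero).1 ?_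
  have h1 : ‖(4 : ℂ) * s ^ 2‖ ≤ ‖κ ^ 2‖ + ‖e‖ := by
    rw [show 4 * s ^ 2 = κ ^ 2 - e by rw [h]; ring]
    exact norm_sub_le _ _
  rw [norm_mul, norm_pow, norm_pow, Complex.norm_ofNat] at h1
  nlinarith [sq_nonneg ‖s‖]

/-- Rests on `κ - 2s = e / (κ + 2s)`, applied twice; `hn` excludes the other branch `κ ≈ -2s`. -/
theorem exists_sqrt_expansion {κ s e : ℂ} (hs : s ≠ 0) (h : κ ^ 2 = 4 * s ^ 2 + e)
    (hn : 2 * ‖s‖ ≤ ‖κ + 2 * s‖) :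
    ∃ k, ‖k‖ ≤ ‖e‖ ^ 2 ∧ κ = 2 * s + e / 4 * s⁻¹ + k * s⁻¹ ^ 3 := by
  have hs0 : 0 < ‖s‖ := norm_pos_iff.2 hs
  have hne : κ + 2 * s ≠ 0 := norm_pos_iff.1 (by linarith)
  refine ⟨-(e ^ 2 * s ^ 2) / (4 * (κ + 2 * s) ^ 2), ?_, ?_⟩
  · rw [norm_div, norm_neg, norm_mul, norm_mul, norm_pow, norm_pow, norm_pow,
      Complex.norm_ofNat, div_le_iff₀ (by positivity)]
    have : ‖s‖ ^ 2 ≤ 4 * ‖κ + 2 * s‖ ^ 2 := by nlinarith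
    exact mul_le_mul_of_nonneg_left this (by positivity)
  · have he : e = (κ - 2 * s) * (κ + 2 * s) := by linear_combination -h
    rw [he]
    field_simp
    ring

theorem exists_inv_sqrt_expansion {κ s e : ℂ} (hs : s ≠ 0) (h : κ ^ 2 = 4 * s ^ 2 + e)
    (hn : 2 * ‖s‖ ≤ ‖κ + 2 * s‖) (hκ : ‖s‖ ≤ ‖κ‖) :
    ∃ m, ‖m‖ ≤ ‖e‖ ∧ κ⁻¹ = s⁻¹ * (1 / 2 + s⁻¹ ^ 2 * m) := by
  have hs0 : 0 < ‖s‖ := norm_pos_iff.2 hs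
  have hne : κ + 2 * s ≠ 0 := norm_pos_iff.1 (by linarith)
  have hκ0 : κ ≠ 0 := norm_pos_iff.1 (by linarith)
  refine ⟨-(e * s ^ 2) / (2 * κ * (κ + 2 * s)), ?_, ?_⟩
  · rw [norm_div, norm_neg, norm_mul, norm_mul, norm_mul, norm_pow,
      Complex.norm_ofNat, div_le_iff₀ (by positivity)]
    have : ‖s‖ ^ 2 ≤ 2 * ‖κ‖ * ‖κ + 2 * s‖ := by nlinarith
    exact mul_le_mul_of_nonneg_left this (by positivity)
  · have he : e = (κ - 2 * s) * (κ + 2 * s) := by linear_combination -h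
    have hm : -(e * s ^ 2) / (2 * κ * (κ + 2 * s)) = -((κ - 2 * s) * s ^ 2) / (2 * κ) := by
      rw [div_eq_div_iff (by simp [hκ0, hne]) (by simp [hκ0]), he]
      ring
    rw [hm]
    field_simp
    ring

/-- Expansion of the value at `0` of a normalised solution in powers of `1 / s`, with remainders
bounded independently of `s`. -/
theorem exists_boundary_expansion (C : ℝ) (e I : ℂ) : ∃ R, ∀ κ s w a P : ℂ,
    1 ≤ ‖s‖ → ‖e‖ ≤ 2 * ‖s‖ ^ 2 → κ ^ 2 = 4 * s ^ 2 + e → 2 * ‖s‖ ≤ ‖κ + 2 * s‖ →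
    κ * w + a = κ - P → ‖a‖ ≤ C / ‖κ‖ → ‖P - (I - I ^ 2 / (2 * κ))‖ ≤ C / ‖κ‖ ^ 2 →
    ∃ k α x : ℂ, ‖k‖ ≤ R ∧ ‖α‖ ≤ R ∧ ‖x‖ ≤ R ∧
      κ = 2 * s + e / 4 * s⁻¹ + k * s⁻¹ ^ 3 ∧ a = s⁻¹ * α ∧
      2 * w = 2 - s⁻¹ * (I + s⁻¹ * ((α - I ^ 2 / 4) + s⁻¹ * x)) := by
  -- The remainder is a polynomial in `(s⁻¹, s a, m, π)`, where `m` and `π` are the scaled errors of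
  -- `κ⁻¹` and `P`. These stay in a fixed ball, so compactness bounds it. The quantity `α = s a` is
  -- kept exact so that it can cancel in the determinant.
  let p : ℂ × ℂ × ℂ × ℂ → ℂ := fun v => v.2.2.2 - I ^ 2 * v.1 * v.2.2.1 / 2
  let X : ℂ × ℂ × ℂ × ℂ → ℂ := fun v => p v +
    2 * v.2.2.1 * (I - I ^ 2 / 4 * v.1 + v.1 ^ 2 * p v + v.1 * v.2.1)
  have hX : Continuous X := by fun_prop
  set R₀ := max 1 (max C ‖e‖)
  obtain ⟨R₁, hR₁⟩ := (isCompact_closedBall (0 : ℂ × ℂ × ℂ × ℂ) R₀).exists_bound_of_continuousOn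
    hX.continuousOn
  refine ⟨max (max C (‖e‖ ^ 2)) R₁, fun κ s w a P hs1 he h hn hw ha hP => ?_⟩
  have hs0 : 0 < ‖s‖ := by linarith
  have hs : s ≠ 0 := norm_pos_iff.1 hs0
  have hsκ := norm_le_of_sq_eq h he
  have hκ0 : 0 < ‖κ‖ := by linarith
  have hκ : κ ≠ 0 := norm_pos_iff.1 hκ0
  obtain ⟨k, hk, hk'⟩ := exists_sqrt_expansion hs h hn
  obtain ⟨m, hm, hm'⟩ := exists_inv_sqrt_expansion hs h hn hsκ
  have hα : ‖s * a‖ ≤ C := by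
    rw [norm_mul]
    rw [le_div_iff₀ hκ0] at ha
    nlinarith [norm_nonneg a]
  set π := s ^ 2 * (P - (I - I ^ 2 / (2 * κ))) with hπdef
  have hπ : ‖π‖ ≤ C := by
    rw [norm_mul, norm_pow]
    rw [le_div_iff₀ (by positivity)] at hP
    refine le_trans ?_ hP
    rw [mul_comm]
    gcongr
  have hball : (s⁻¹, s * a, m, π) ∈ Metric.closedBall (0 : ℂ × ℂ × ℂ × ℂ) R₀ := by
    rw [mem_closedBall_zero_iff]
    have h1 : ‖s⁻¹‖ ≤ 1 := by rw [norm_inv]; exact inv_le_one_of_one_le₀ hs1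
    have h2 : C ≤ R₀ := (le_max_left _ _).trans (le_max_right _ _)
    refine max_le (h1.trans (le_max_left _ _)) (max_le (hα.trans h2) (max_le ?_ (hπ.trans h2)))
    exact hm.trans ((le_max_right _ _).trans (le_max_right _ _))
  refine ⟨k, s * a, X (s⁻¹, s * a, m, π), hk.trans ((le_max_right _ _).trans (le_max_left _ _)),
    hα.trans ((le_max_left _ _).trans (le_max_left _ _)),
    (hR₁ _ hball).trans (le_max_right _ _), hk', by field_simp, ?_⟩
  have hw' : w = 1 - (P + a) * κ⁻¹ := by
    field_simp
    linear_combination hw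
  have hP' : P = I - I ^ 2 / 2 * κ⁻¹ + s⁻¹ ^ 2 * π := by
    rw [hπdef]
    field_simp
    ring
  have ha' : a = s⁻¹ * (s * a) := by field_simp
  simp only [X, p]
  generalize s * a = α at *
  rw [hw', hP', hm', ha']
  ring

/-- The expansion of the determinant in terms of the expansions of the two boundary values. -/
theorem exists_det_expansion (e₁ e₂ I₁ I₂ : ℂ) (R : ℝ) : ∃ C : ℝ,
    ∀ s κ₁ κ₂ w₁ w₂ a₁ a₂ k₁ k₂ α₁ α₂ x₁ x₂ : ℂ, 1 ≤ ‖s‖ →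
    ‖k₁‖ ≤ R → ‖k₂‖ ≤ R → ‖α₁‖ ≤ R → ‖α₂‖ ≤ R → ‖x₁‖ ≤ R → ‖x₂‖ ≤ R →
    κ₁ = 2 * s + e₁ / 4 * s⁻¹ + k₁ * s⁻¹ ^ 3 → κ₂ = 2 * s + e₂ / 4 * s⁻¹ + k₂ * s⁻¹ ^ 3 →
    a₁ = s⁻¹ * α₁ → a₂ = s⁻¹ * α₂ →
    2 * w₁ = 2 - s⁻¹ * (I₁ + s⁻¹ * ((α₁ - I₁ ^ 2 / 4) + s⁻¹ * x₁)) →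
    2 * w₂ = 2 - s⁻¹ * (I₂ + s⁻¹ * ((α₂ - I₂ ^ 2 / 4) + s⁻¹ * x₂)) →
    ‖(-(κ₁ + κ₂) / 2 * w₁ * w₂ - w₁ * a₂ - w₂ * a₁) -
      (-2 * s + (I₁ + I₂) - 1 / 4 * s⁻¹ * ((I₁ + I₂) ^ 2 + (e₁ + e₂) / 2))‖
      ≤ C * ‖s⁻¹ ^ 2‖ := by
  -- The error divided by `s⁻²`: a polynomial, hence bounded on the compact ball. In order `s⁻¹` the
  -- terms `α₁ + α₂` produced by `-2s * w₁ * w₂` cancel those of `-w₁ * a₂ - w₂ * a₁`.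
  let Q : ℂ × ℂ × ℂ × ℂ × ℂ × ℂ × ℂ → ℂ := fun ⟨t, k₁, k₂, α₁, α₂, x₁, x₂⟩ =>
    let r₁ := (α₁ - I₁ ^ 2 / 4) + t * x₁
    let r₂ := (α₂ - I₂ ^ 2 / 4) + t * x₂
    let X₁ := (I₁ + t * r₁) / 2
    let X₂ := (I₂ + t * r₂) / 2
    let E := (e₁ + e₂) / 8
    let K := (k₁ + k₂) / 2
    E * (X₁ + X₂) - E * t * (X₁ * X₂) - t * K * (1 - t * (X₁ + X₂) + t ^ 2 * (X₁ * X₂))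
      + X₁ * α₂ + X₂ * α₁ + x₁ + x₂ - (I₁ * r₂ + I₂ * r₁ + t * r₁ * r₂) / 2
  have hQ : Continuous Q := by fun_prop
  obtain ⟨C, hC⟩ := (isCompact_closedBall (0 : ℂ × ℂ × ℂ × ℂ × ℂ × ℂ × ℂ)
    (max 1 R)).exists_bound_of_continuousOn hQ.continuousOn
  refine ⟨C, fun s κ₁ κ₂ w₁ w₂ a₁ a₂ k₁ k₂ α₁ α₂ x₁ x₂ hs1 hk₁ hk₂ hα₁ hα₂ hx₁ hx₂
    eκ₁ eκ₂ ea₁ ea₂ ew₁ ew₂ => ?_⟩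
  have hs : s ≠ 0 := norm_pos_iff.1 (by linarith)
  have h1 : ‖s⁻¹‖ ≤ 1 := by rw [norm_inv]; exact inv_le_one_of_one_le₀ hs1
  have hb := hC (s⁻¹, k₁, k₂, α₁, α₂, x₁, x₂) (by
    rw [mem_closedBall_zero_iff]
    have hR : R ≤ max 1 R := le_max_right _ _
    exact max_le (h1.trans (le_max_left _ _)) (max_le (hk₁.trans hR) (max_le (hk₂.trans hR)
      (max_le (hα₁.trans hR) (max_le (hα₂.trans hR) (max_le (hx₁.trans hR) (hx₂.trans hR)))))))
  have hst : s * s⁻¹ = 1 := mul_inv_cancel₀ hs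
  have key : (-(κ₁ + κ₂) / 2 * w₁ * w₂ - w₁ * a₂ - w₂ * a₁) -
      (-2 * s + (I₁ + I₂) - 1 / 4 * s⁻¹ * ((I₁ + I₂) ^ 2 + (e₁ + e₂) / 2))
      = Q (s⁻¹, k₁, k₂, α₁, α₂, x₁, x₂) * s⁻¹ ^ 2 := by
    have ew₁' : w₁ = 1 - s⁻¹ * (I₁ + s⁻¹ * ((α₁ - I₁ ^ 2 / 4) + s⁻¹ * x₁)) / 2 := by
      linear_combination ew₁ / 2
    have ew₂' : w₂ = 1 - s⁻¹ * (I₂ + s⁻¹ * ((α₂ - I₂ ^ 2 / 4) + s⁻¹ * x₂)) / 2 := by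
      linear_combination ew₂ / 2
    rw [eκ₁, eκ₂, ea₁, ea₂, ew₁', ew₂']
    simp only [Q]
    field_simp
    ring
  rw [key, norm_mul]
  gcongr

end Expansions

/-! ### Expansion for a travelling wave, and the main theorem. -/

theorem exists_jost_expansion {f u u' : ℝ → ℝ} {c um up : ℝ} (hf : ContDiff ℝ 2 f)
    (h : IsFrontProfile f c u u' um up) (hi : IntegrableOn (evansPhi f u um) (Iic 0)) :
    ∃ R, ∀ (z : ℂ) (w w' : ℝ → ℂ), R ≤ ‖z ^ (1 / 2 : ℂ)‖ → |c| < (evansKappa f c um z).re →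
      IsJost (evansPhi f u um) (evansKappa f c um z) w w' →
      ∃ k α x : ℂ, ‖k‖ ≤ R ∧ ‖α‖ ≤ R ∧ ‖x‖ ≤ R ∧
        evansKappa f c um z = 2 * z ^ (1 / 2 : ℂ)
          + ((c : ℂ) ^ 2 - 4 * ((deriv f um : ℝ) : ℂ)) / 4 * (z ^ (1 / 2 : ℂ))⁻¹
          + k * (z ^ (1 / 2 : ℂ))⁻¹ ^ 3 ∧
        w' 0 = (z ^ (1 / 2 : ℂ))⁻¹ * α ∧
        2 * w 0 = 2 - (z ^ (1 / 2 : ℂ))⁻¹ * (((∫ x in Iic 0, evansPhi f u um x : ℝ) : ℂ)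
          + (z ^ (1 / 2 : ℂ))⁻¹ * ((α - ((∫ x in Iic 0, evansPhi f u um x : ℝ) : ℂ) ^ 2 / 4)
            + (z ^ (1 / 2 : ℂ))⁻¹ * x)) := by
  have hf2 : ContDiff ℝ (1 + 1) f := by simpa [one_add_one_eq_two] using hf
  have hf' : ContDiff ℝ 1 (deriv f) := (contDiff_succ_iff_deriv.1 hf2).2.2
  have hf1 : ContDiff ℝ 1 f := hf.of_le (by norm_num)
  have hφd : ∀ x, HasDerivAt (evansPhi f u um) (deriv (deriv f) (u x) * u' x) x := fun x =>
    ((hf'.differentiable one_ne_zero (u x)).hasDerivAt.comp x (h.hasDerivAt x)).sub_const _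
  have hφ : Continuous (evansPhi f u um) :=
    continuous_iff_continuousAt.2 fun x => (hφd x).continuousAt
  have hφ0 : Tendsto (evansPhi f u um) atBot (𝓝 0) := by
    rw [← sub_self (deriv f um)]
    exact ((hf'.continuous.tendsto um).comp h.tendsto_atBot).sub_const (deriv f um)
  obtain ⟨B, hB⟩ := h.exists_comparison hf1 (hf'.continuous_deriv le_rfl)
  obtain ⟨C, hC⟩ := IsJost.exists_bounds hφd hi hφ0 B
  set e : ℂ := (c : ℂ) ^ 2 - 4 * ((deriv f um : ℝ) : ℂ) with he
  set N := ∫ t in Iic 0, |evansPhi f u um t|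
  obtain ⟨R, hR⟩ := exists_boundary_expansion C e ((∫ x in Iic 0, evansPhi f u um x : ℝ) : ℂ)
  refine ⟨max R (max (4 * N) (1 + ‖e‖)), fun z w w' hz hκ hw => ?_⟩
  set s := z ^ (1 / 2 : ℂ)
  set κ := evansKappa f c um z
  have hs1 : 1 ≤ ‖s‖ := by
    linarith [(le_max_right _ _).trans ((le_max_right R _).trans hz), norm_nonneg e]
  have hse : ‖e‖ ≤ 2 * ‖s‖ ^ 2 := by
    nlinarith [(le_max_right _ _).trans ((le_max_right R _).trans hz)]
  have hsq : κ ^ 2 = 4 * s ^ 2 + e := by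
    rw [evansKappa_sq, cpow_half_sq, he]
    ring
  have hκ0 : 0 < κ.re := (abs_nonneg c).trans_lt hκ
  -- The shift `e = c² - 4 f'(um)` is real, so `κ²` and `4 s²` have the same imaginary part.
  have him : (κ ^ 2).im = (4 * s ^ 2).im := by
    rw [hsq, Complex.add_im, add_eq_left, he]
    simp [pow_two]
  have hN : 4 * N ≤ ‖κ‖ :=
    ((le_max_left _ _).trans ((le_max_right R _).trans hz)).trans (norm_le_of_sq_eq hsq hse)
  obtain ⟨ha, hP⟩ := hC κ w w' hκ0 hN (hB κ.re hκ.le) hw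
  obtain ⟨k, α, x, hk, hα, hx, hrest⟩ := hR κ s (w 0) (w' 0) _ hs1 hse hsq
    (two_mul_norm_le_norm_add hκ0 (re_cpow_half_nonneg z) him) (hw.mul_add_eq hφ hi 0) ha hP
  exact ⟨k, α, x, hk.trans (le_max_left _ _), hα.trans (le_max_left _ _),
    hx.trans (le_max_left _ _), hrest⟩

theorem mainTheorem1 (f u : ℝ → ℝ) (c um up : ℝ)
    (hf : ContDiff ℝ 2 f)
    (hu : IsTravellingWave f c u)
    (hum : Tendsto u atBot (𝓝 um))
    (hup : Tendsto u atTop (𝓝 up))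
    (hphim : IntegrableOn (evansPhi f u um) (Iic 0))
    (hphip : IntegrableOn (evansPhi f u up) (Ioi 0)) :
    (∀ z ∈ evansDomain f c um up,
      (∃! y : ℝ → Fin 2 → ℂ, IsLeftSolution f c u um z y) ∧
      (∃! y : ℝ → Fin 2 → ℂ, IsRightSolution f c u up z y)) ∧
    Asymptotics.IsBigO (Bornology.cobounded ℂ ⊓ 𝓟 (evansDomain f c um up))
      (fun z : ℂ => evansFunction f c u um up z -
        (-2 * z ^ (1 / 2 : ℂ) + (evansPhiTotal f u um up : ℂ) -
          (1 / 4) * z ^ (-(1 / 2) : ℂ) *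
            ((evansPhiTotal f u um up : ℂ) ^ 2 - 2 * ((deriv f um : ℝ) : ℂ) - 2 * ((deriv f up : ℝ) : ℂ)
              + (c : ℂ) ^ 2)))
      (fun z : ℂ => z⁻¹) := by
  have hprof := hu.isFrontProfile hum hup
  have hprof' := hprof.reflect
  have hf' : Continuous (deriv f) := hf.continuous_deriv (by norm_num)
  obtain ⟨B, hB⟩ := hprof.exists_norm_comp_le hf'
  simp only [Real.norm_eq_abs] at hB
  have hphip' : IntegrableOn (evansPhi f (fun x => u (-x)) up) (Iic 0) := by
    have : IntegrableOn (evansPhi f u up) (Ici (-0)) := by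
      rw [neg_zero]; exact (integrableOn_Ici_iff_integrableOn_Ioi).mpr hphip
    exact this.comp_neg_Iic
  have hφc : ∀ {v : ℝ → ℝ} (q : ℝ), Continuous v → Continuous (evansPhi f v q) := fun q hv =>
    (hf'.comp hv).sub continuous_const
  have hκpos : ∀ z ∈ evansDomain f c um up, 0 < (evansKappa f c um z).re ∧
      0 < (evansKappa f c up z).re := fun z hz =>
    ⟨(abs_nonneg c).trans_lt (abs_lt_re_evansKappa hz).1,
      (abs_nonneg c).trans_lt (abs_lt_re_evansKappa hz).2⟩
  have hleft : ∀ z ∈ evansDomain f c um up, ∃ w w',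
      IsJost (evansPhi f u um) (evansKappa f c um z) w w' := fun z hz =>
    exists_isJost (hφc um hprof.continuous) hphim (hκpos z hz).1
  have hright : ∀ z ∈ evansDomain f c um up, ∃ w w',
      IsJost (evansPhi f (fun x => u (-x)) up) (evansKappa f c up z) w w' := fun z hz =>
    exists_isJost (hφc up hprof'.continuous) hphip' (hκpos z hz).2
  refine ⟨fun z hz => ⟨?_, ?_⟩, ?_⟩
  · obtain ⟨w, w', hw⟩ := hleft z hz
    exact ⟨_, isLeftSolution_expSolution hw, fun y hy =>
      hy.unique hB hz (isLeftSolution_expSolution hw)⟩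
  · obtain ⟨w, w', hw⟩ := hright z hz
    exact ⟨_, isRightSolution_expSolution hw, fun y hy =>
      hy.unique hB hz (isRightSolution_expSolution hw)⟩
  · obtain ⟨R₁, hR₁⟩ := exists_jost_expansion hf hprof hphim
    obtain ⟨R₂, hR₂⟩ := exists_jost_expansion hf hprof' hphip'
    set I₁ : ℝ := ∫ x in Iic 0, evansPhi f u um x with hI₁
    set I₂ : ℝ := ∫ x in Iic 0, evansPhi f (fun x => u (-x)) up x with hI₂
    have hΦ : evansPhiTotal f u um up = I₁ + I₂ := by
      have h2 : I₂ = ∫ x in Ioi (-0), evansPhi f u up x :=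
        integral_comp_neg_Iic 0 (evansPhi f u up)
      rw [evansPhiTotal, h2, neg_zero]
    obtain ⟨C, hC⟩ := exists_det_expansion ((c : ℂ) ^ 2 - 4 * ((deriv f um : ℝ) : ℂ))
      ((c : ℂ) ^ 2 - 4 * ((deriv f up : ℝ) : ℂ)) I₁ I₂ (max R₁ R₂)
    refine Asymptotics.IsBigO.of_bound C ?_
    have hlarge := (tendsto_norm_cpow_half.eventually_ge_atTop (max 1 (max R₁ R₂))).filter_mono
      (inf_le_left : Bornology.cobounded ℂ ⊓ 𝓟 (evansDomain f c um up) ≤ _)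
    filter_upwards [hlarge, mem_inf_of_right (mem_principal_self _)] with z hlz hz
    obtain ⟨w, w', hw⟩ := hleft z hz
    obtain ⟨v, v', hv⟩ := hright z hz
    obtain ⟨hc₁, hc₂⟩ := abs_lt_re_evansKappa hz
    have hR : max R₁ R₂ ≤ ‖z ^ (1 / 2 : ℂ)‖ := (le_max_right _ _).trans hlz
    -- The reflected profile has speed `-c`, but `κ` depends only on `c²`.
    have hneg : evansKappa f (-c) up z = evansKappa f c up z := by simp [evansKappa]
    obtain ⟨k₁, α₁, x₁, hk₁, hα₁, hx₁, eκ₁, ea₁, ew₁⟩ :=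
      hR₁ z w w' ((le_max_left _ _).trans hR) hc₁ hw
    obtain ⟨k₂, α₂, x₂, hk₂, hα₂, hx₂, eκ₂, ea₂, ew₂⟩ :=
      hR₂ z v v' ((le_max_right _ _).trans hR) (by rwa [hneg, abs_neg]) (by rwa [hneg])
    rw [hneg, Complex.ofReal_neg, neg_sq] at eκ₂
    have hl : R₁ ≤ max R₁ R₂ := le_max_left _ _
    have hr : R₂ ≤ max R₁ R₂ := le_max_right _ _
    have hmain := hC _ _ _ _ _ _ _ _ _ _ _ _ _ ((le_max_left _ _).trans hlz) (hk₁.trans hl)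
      (hk₂.trans hr) (hα₁.trans hl) (hα₂.trans hr) (hx₁.trans hl) (hx₂.trans hr)
      eκ₁ eκ₂ ea₁ ea₂ ew₁ ew₂
    rw [inv_pow, cpow_half_sq] at hmain
    rw [evansFunction_eq hB hz hw hv, hΦ, Complex.cpow_neg]
    refine le_of_eq_of_le ?_ hmain
    congr 1
    push_cast
    ring
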